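/- Let $\mathbb{K}$ be a field. An $\mathcal{N}$-algebra over $\mathbb{K}$ is a $\mathbb{K}$-vector space $V$ with multilinear operations $N_n : V^{\otimes n}\to V$, one for each $n\ge 2$, such that for all elements of $V$: (1) for $n\ge 2$, $$N_n(x_1,\ldots,x_{n-1},N_2(x_n,x_{n+1}))=\sum_{i=1}^{n-1}N_{i+1}(x_1,\ldots,x_{i-1},N_{n-i+1}(x_i,\ldots,x_n),x_{n+1});$$ (2) for $n\ge 3$, $$N_2(x_1,N_n(x_2,\ldots,x_{n+1}))=N_n(N_2(x_1,x_2),x_3,\ldots,x_{n+1})-\sum_{i=3}^{n}N_i(x_1,N_{n+2-i}(x_2,\ldots,x_{n+3-i}),x_{n+4-i},\ldots,x_{n+1});$$ (3) for $n,r\ge 3$, $$\begin{aligned}N_n(x,y_1,\ldots,y_{n-2},N_r(z,t_1,\ldots,t_{r-2},w))={}&N_r(N_n(x,y_1,\ldots,y_{n-2},z),t_1,\ldots,t_{r-2},w)\\&+\sum_{i=1}^{n-2}N_{r+i}(x,y_1,\ldots,y_{i-1},N_{n-i}(y_i,\ldots,y_{n-2},z),t_1,\ldots,t_{r-2},w)\\&-\sum_{i=1}^{r-2}N_{n+r-i-1}(x,y_1,\ldots,y_{n-2},N_{i+1}(z,t_1,\ldots,t_i),t_{i+1},\ldots,t_{r-2},w).\end{aligned}$$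 Let $\mathcal{N}$ be the symmetric operad of $\mathcal{N}$-algebras: $\mathcal{N}(n)$ is the multilinear part of the free $\mathcal{N}$-algebra on $n$ variables $x_1,\dots,x_n$ (the span of the monomials containing each variable exactly once), the symmetric group $S_n$ acts by permuting the variables, and composition is substitution. Let $\mathcal{N}_n\subseteq\mathcal{N}(n)$ be the span of the monomials in which the variables occur in the order $x_1,\ldots,x_n$. A non-symmetric operad inside $\mathcal N$ is a family of subspaces $Q_n\subseteq\mathcal{N}(n)$, $n\ge 0$, containing the unit of $\mathcal{N}$ and closed under the order-preserving compositions $Q_k\otimes Q_{n_1}\otimes\cdots\otimes Q_{n_k}\to Q_{n_1+\cdots+n_k}$. Then: (a) $\mathcal{N}$ is regular (non-symmetric), that is, it is the symmetrization of a non-symmetric operad. More precisely, the family $(\mathcal{N}_n)_{n\ge 0}$ is a non-symmetric operad inside $\mathcal{N}$, and for every $n$ the $S_n$-equivariant map $\mathcal{N}_n\otimes\mathbb{K}[S_n]\to\mathcal{N}(n)$, $q\otimes\sigma\mapsto\sigma\cdot q$, is an isomorphism. (b) For every $n\ge 1$, $\dim_{\mathbb{K}}\mathcal{N}_n=c_{n-1}$,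 where $c_m=\frac{1}{m+1}\binom{2m}{m}$ is the $m$-th Catalan number. The same holds for any non-symmetric operad $(Q_n)$ inside $\mathcal N$ for which all the maps $Q_n\otimes\mathbb{K}[S_n]\to\mathcal{N}(n)$ are isomorphisms. -/

import Mathlib

open scoped TensorProduct

universe u v w

/-! ### `𝒩`-algebras -/

/-- A family of operations of arities `2, 3, 4, …`, applied to a list of arguments: the operation of
arity `k` is used on a list of length `k`. (Lists of length `< 2` get the value `0`; they never
occur below.) -/
def applyOp {A : Type v} [Zero A] (N : ∀ n : ℕ, (Fin (n + 2) → A) → A) : List A → A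
  | a :: b :: l => N l.length (fun i => (a :: b :: l).get i)
  | _ => 0

/-- An `𝒩`-algebra over `K`: a vector space with multilinear operations `N n` of arity `n + 2`, for
all `n : ℕ` (that is, one operation in each arity `≥ 2`), satisfying three families of relations.
Here `applyOp N [x₁, …, xₖ]` is `Nₖ(x₁, …, xₖ)`. -/
class NAlgebra (K : Type u) (A : Type v) [Field K] [AddCommGroup A] [Module K A] where
  N : ∀ n : ℕ, MultilinearMap K (fun _ : Fin (n + 2) => A) A
  /-- `Nₙ(x₁, …, xₙ₋₁, N₂(xₙ, xₙ₊₁)) = ∑_{1 ≤ i ≤ n-1} Nᵢ₊₁(x₁, …, xᵢ₋₁, Nₙ₋ᵢ₊₁(xᵢ, …, xₙ), xₙ₊₁)`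
  for `n ≥ 2`, with `xs = [x₁, …, xₙ₋₁]`, `y = xₙ`, `z = xₙ₊₁`. -/
  rel_one : ∀ (xs : List A) (y z : A), xs ≠ [] →
    applyOp (fun n => N n) (xs ++ [applyOp (fun n => N n) [y, z]]) =
      ∑ i ∈ Finset.range xs.length,
        applyOp (fun n => N n) (xs.take i ++ [applyOp (fun n => N n) (xs.drop i ++ [y]), z])
  /-- `N₂(a, Nₙ(b, t₁, …, tₙ₋₂, w)) = Nₙ(N₂(a, b), t₁, …, tₙ₋₂, w)
    - ∑_{1 ≤ j ≤ n-2} Nₙ₊₁₋ⱼ(a, Nⱼ₊₁(b, t₁, …, tⱼ), tⱼ₊₁, …, tₙ₋₂, w)` for `n ≥ 3`. -/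
  rel_two : ∀ (a b : A) (ts : List A) (w : A), ts ≠ [] →
    applyOp (fun n => N n) [a, applyOp (fun n => N n) (b :: ts ++ [w])] =
      applyOp (fun n => N n) (applyOp (fun n => N n) [a, b] :: ts ++ [w]) -
        ∑ j ∈ Finset.range ts.length,
          applyOp (fun n => N n)
            (a :: applyOp (fun n => N n) (b :: ts.take (j + 1)) :: ts.drop (j + 1) ++ [w])
  /-- For `n, r ≥ 3`, `Nₙ(x, y₁, …, yₙ₋₂, Nᵣ(z, t₁, …, tᵣ₋₂, w)) =
    Nᵣ(Nₙ(x, y₁, …, yₙ₋₂, z), t₁, …, tᵣ₋₂, w)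
    + ∑_{1 ≤ i ≤ n-2} Nᵣ₊ᵢ(x, y₁, …, yᵢ₋₁, Nₙ₋ᵢ(yᵢ, …, yₙ₋₂, z), t₁, …, tᵣ₋₂, w)
    - ∑_{1 ≤ i ≤ r-2} Nₙ₊ᵣ₋ᵢ₋₁(x, y₁, …, yₙ₋₂, Nᵢ₊₁(z, t₁, …, tᵢ), tᵢ₊₁, …, tᵣ₋₂, w)`. -/
  rel_three : ∀ (x : A) (ys : List A) (z : A) (ts : List A) (w : A), ys ≠ [] → ts ≠ [] →
    applyOp (fun n => N n) (x :: ys ++ [applyOp (fun n => N n) (z :: ts ++ [w])]) =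
      applyOp (fun n => N n) (applyOp (fun n => N n) (x :: ys ++ [z]) :: ts ++ [w]) +
        ∑ i ∈ Finset.range ys.length,
          applyOp (fun n => N n)
            (x :: ys.take i ++ applyOp (fun n => N n) (ys.drop i ++ [z]) :: ts ++ [w]) -
        ∑ i ∈ Finset.range ts.length,
          applyOp (fun n => N n)
            (x :: ys ++ applyOp (fun n => N n) (z :: ts.take (i + 1)) :: ts.drop (i + 1) ++ [w])

/-! ### The free `𝒩`-algebra on a set -/

namespace FreeNAlgebra

/-- Formal expressions in the variables `X`. -/
inductive Pre (K : Type u) (X : Type v) : Type (max u v)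
  | of : X → Pre K X
  | zero : Pre K X
  | add : Pre K X → Pre K X → Pre K X
  | smul : K → Pre K X → Pre K X
  | node : (n : ℕ) → (Fin (n + 2) → Pre K X) → Pre K X

variable {K : Type u} {X : Type v} [Field K]

instance : Zero (Pre K X) := ⟨Pre.zero⟩

/-- Formal finite sum `g 0 + … + g (m - 1)`. -/
def Pre.sum (m : ℕ) (g : ℕ → Pre K X) : Pre K X :=
  Nat.rec Pre.zero (fun i s => Pre.add s (g i)) m

/-- The operation of arity `l.length` applied to the list `l` of formal expressions. -/
def Pre.op (l : List (Pre K X)) : Pre K X := applyOp Pre.node l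

/-- The congruence generated by the vector space axioms, multilinearity of the operations and the
relations of an `𝒩`-algebra (written without subtraction). -/
inductive Rel : Pre K X → Pre K X → Prop
  | refl (a) : Rel a a
  | symm {a b} : Rel a b → Rel b a
  | trans {a b c} : Rel a b → Rel b c → Rel a c
  | add_congr {a b c d} : Rel a b → Rel c d → Rel (.add a c) (.add b d)
  | smul_congr (r : K) {a b} : Rel a b → Rel (.smul r a) (.smul r b)
  | node_congr (n : ℕ) {f g : Fin (n + 2) → Pre K X} :
      (∀ i, Rel (f i) (g i)) → Rel (.node n f) (.node n g)
  | add_assoc (a b c) : Rel (.add (.add a b) c) (.add a (.add b c))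
  | add_comm (a b) : Rel (.add a b) (.add b a)
  | zero_add (a) : Rel (.add .zero a) a
  | neg_add (a) : Rel (.add (.smul (-1) a) a) .zero
  | smul_add (r : K) (a b) : Rel (.smul r (.add a b)) (.add (.smul r a) (.smul r b))
  | add_smul (r s : K) (a) : Rel (.smul (r + s) a) (.add (.smul r a) (.smul s a))
  | mul_smul (r s : K) (a) : Rel (.smul (r * s) a) (.smul r (.smul s a))
  | one_smul (a) : Rel (.smul 1 a) a
  | node_add (n : ℕ) (f : Fin (n + 2) → Pre K X) (i : Fin (n + 2)) (a b) :
      Rel (.node n (Function.update f i (.add a b)))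
        (.add (.node n (Function.update f i a)) (.node n (Function.update f i b)))
  | node_smul (n : ℕ) (f : Fin (n + 2) → Pre K X) (i : Fin (n + 2)) (r : K) (a) :
      Rel (.node n (Function.update f i (.smul r a))) (.smul r (.node n (Function.update f i a)))
  | rel_one (xs : List (Pre K X)) (y z : Pre K X) : xs ≠ [] →
      Rel (.op (xs ++ [.op [y, z]]))
        (.sum xs.length fun i => .op (xs.take i ++ [.op (xs.drop i ++ [y]), z]))
  | rel_two (a b : Pre K X) (ts : List (Pre K X)) (w : Pre K X) : ts ≠ [] →
      Rel (.add (.op [a, .op (b :: ts ++ [w])])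
          (.sum ts.length fun j =>
            .op (a :: .op (b :: ts.take (j + 1)) :: ts.drop (j + 1) ++ [w])))
        (.op (.op [a, b] :: ts ++ [w]))
  | rel_three (x : Pre K X) (ys : List (Pre K X)) (z : Pre K X) (ts : List (Pre K X))
      (w : Pre K X) : ys ≠ [] → ts ≠ [] →
      Rel (.add (.op (x :: ys ++ [.op (z :: ts ++ [w])]))
          (.sum ts.length fun i =>
            .op (x :: ys ++ .op (z :: ts.take (i + 1)) :: ts.drop (i + 1) ++ [w])))
        (.add (.op (.op (x :: ys ++ [z]) :: ts ++ [w]))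
          (.sum ys.length fun i =>
            .op (x :: ys.take i ++ .op (ys.drop i ++ [z]) :: ts ++ [w])))

variable (K X) in
/-- Provable equality of formal expressions. -/
def preSetoid : Setoid (Pre K X) := ⟨Rel, Rel.refl, Rel.symm, Rel.trans⟩

end FreeNAlgebra

open FreeNAlgebra in
/-- The free `𝒩`-algebra over `K` on the set `X`. -/
def FreeNAlgebra (K : Type u) (X : Type v) [Field K] : Type (max u v) :=
  Quotient (preSetoid K X)

namespace FreeNAlgebra

variable {K : Type u} {X : Type v} [Field K]

/-- The class of a formal expression. -/
def mk (a : Pre K X) : FreeNAlgebra K X := Quotient.mk (preSetoid K X) a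

theorem mk_eq {a b : Pre K X} (h : Rel a b) : mk a = mk b := Quotient.sound h

/-- A chosen expression of an element. -/
noncomputable def rep (a : FreeNAlgebra K X) : Pre K X := Quotient.out a

@[simp] theorem mk_rep (a : FreeNAlgebra K X) : mk (rep a) = a := Quotient.out_eq a

theorem rel_of_eq {a b : Pre K X} (h : mk a = mk b) : Rel a b := Quotient.exact h

theorem rep_mk (a : Pre K X) : Rel (rep (mk a)) a := rel_of_eq (mk_rep _)

theorem exists_mk (a : FreeNAlgebra K X) : ∃ a', mk a' = a := ⟨rep a, mk_rep a⟩

theorem exists_map_mk (l : List (FreeNAlgebra K X)) : ∃ l' : List (Pre K X), l'.map mk = l :=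
  ⟨l.map rep, by rw [List.map_map]; exact (List.map_congr_left fun a _ => mk_rep a).trans l.map_id⟩

instance : Zero (FreeNAlgebra K X) := ⟨mk .zero⟩

instance : Add (FreeNAlgebra K X) :=
  ⟨Quotient.map₂ Pre.add fun _ _ h _ _ h' => Rel.add_congr h h'⟩

instance : Neg (FreeNAlgebra K X) :=
  ⟨Quotient.map (Pre.smul (-1)) fun _ _ h => Rel.smul_congr _ h⟩

instance : AddCommGroup (FreeNAlgebra K X) where
  add_assoc := by rintro ⟨a⟩ ⟨b⟩ ⟨c⟩; exact mk_eq (.add_assoc a b c)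
  add_comm := by rintro ⟨a⟩ ⟨b⟩; exact mk_eq (.add_comm a b)
  zero_add := by rintro ⟨a⟩; exact mk_eq (.zero_add a)
  add_zero := by rintro ⟨a⟩; exact mk_eq (.trans (.add_comm _ _) (.zero_add a))
  neg_add_cancel := by rintro ⟨a⟩; exact mk_eq (.neg_add a)
  nsmul := nsmulRec
  zsmul := zsmulRec

instance : SMul K (FreeNAlgebra K X) :=
  ⟨fun r => Quotient.map (Pre.smul r) fun _ _ h => Rel.smul_congr _ h⟩

instance : Module K (FreeNAlgebra K X) :=
  Module.ofMinimalAxioms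
    (by rintro r ⟨a⟩ ⟨b⟩; exact mk_eq (.smul_add r a b))
    (by rintro r s ⟨a⟩; exact mk_eq (.add_smul r s a))
    (by rintro r s ⟨a⟩; exact mk_eq (.mul_smul r s a))
    (by rintro ⟨a⟩; exact mk_eq (.one_smul a))

theorem mk_zero : mk (.zero : Pre K X) = 0 := rfl
theorem mk_add (a b : Pre K X) : mk (.add a b) = mk a + mk b := rfl
theorem mk_smul (r : K) (a : Pre K X) : mk (.smul r a) = r • mk a := rfl

theorem mk_sum (m : ℕ) (g : ℕ → Pre K X) : mk (.sum m g) = ∑ i ∈ Finset.range m, mk (g i) := by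
  induction m with
  | zero => rfl
  | succ m ih => rw [Finset.sum_range_succ, ← ih]; rfl

/-- The operation of arity `n + 2` on the free `𝒩`-algebra. -/
noncomputable def nodeFun (n : ℕ) (f : Fin (n + 2) → FreeNAlgebra K X) : FreeNAlgebra K X :=
  mk (.node n fun i => rep (f i))

theorem nodeFun_mk (n : ℕ) (f : Fin (n + 2) → Pre K X) :
    nodeFun n (fun i => mk (f i)) = mk (.node n f) :=
  mk_eq (.node_congr n fun i => rep_mk (f i))

theorem nodeFun_update (n : ℕ) (f : Fin (n + 2) → FreeNAlgebra K X) (i : Fin (n + 2))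
    (a : Pre K X) : nodeFun n (Function.update f i (mk a)) =
      mk (.node n (Function.update (fun j => rep (f j)) i a)) := by
  rw [← nodeFun_mk]
  congr 1
  funext j
  rcases eq_or_ne j i with rfl | h
  · simp
  · simp [h]

/-- The operation of arity `n + 2` on the free `𝒩`-algebra, as a multilinear map. -/
noncomputable def nodeMul (n : ℕ) :
    MultilinearMap K (fun _ : Fin (n + 2) => FreeNAlgebra K X) (FreeNAlgebra K X) where
  toFun := nodeFun n
  map_update_add' := by
    intro d f i a b
    obtain rfl : d = instDecidableEqFin (n + 2) := Subsingleton.elim _ _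
    obtain ⟨a, rfl⟩ : ∃ a', mk a' = a := exists_mk _
    obtain ⟨b, rfl⟩ : ∃ a', mk a' = b := exists_mk _
    rw [← mk_add, nodeFun_update, nodeFun_update, nodeFun_update]
    exact mk_eq (.node_add n _ i a b)
  map_update_smul' := by
    intro d f i r a
    obtain rfl : d = instDecidableEqFin (n + 2) := Subsingleton.elim _ _
    obtain ⟨a, rfl⟩ : ∃ a', mk a' = a := exists_mk _
    rw [← mk_smul, nodeFun_update, nodeFun_update]
    exact mk_eq (.node_smul n _ i r a)

theorem applyOp_mk (l : List (Pre K X)) :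
    applyOp (fun n => (nodeMul n : (Fin (n + 2) → FreeNAlgebra K X) → FreeNAlgebra K X))
      (l.map mk) = mk (Pre.op l) := by
  match l with
  | [] => rfl
  | [_] => rfl
  | a :: b :: l =>
    have key : ∀ (n m : ℕ) (h : m = n) (f : Fin (m + 2) → FreeNAlgebra K X)
        (g : Fin (n + 2) → Pre K X),
        (∀ i, f i = mk (g (Fin.cast (by rw [h]) i))) → nodeFun m f = mk (.node n g) := by
      rintro n m rfl f g hfg
      rw [← nodeFun_mk]
      congr 1
      funext i
      exact hfg i
    exact key l.length (l.map mk).length (by simp) _ _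
      (fun i => by
        change ((a :: b :: l).map mk)[i.1]'_ = _
        rw [List.getElem_map]
        rfl)

noncomputable instance instNAlgebra : NAlgebra K (FreeNAlgebra K X) where
  N := nodeMul
  rel_one xs y z hxs := by
    obtain ⟨xs, rfl⟩ : ∃ l' : List (Pre K X), l'.map mk = xs := exists_map_mk _
    obtain ⟨y, rfl⟩ : ∃ a', mk a' = y := exists_mk _
    obtain ⟨z, rfl⟩ : ∃ a', mk a' = z := exists_mk _
    have h := mk_eq (Rel.rel_one xs y z (by simpa using hxs))
    simpa [mk_sum, ← applyOp_mk, ← List.map_take, ← List.map_drop] using h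
  rel_two a b ts w hts := by
    obtain ⟨ts, rfl⟩ : ∃ l' : List (Pre K X), l'.map mk = ts := exists_map_mk _
    obtain ⟨a, rfl⟩ : ∃ a', mk a' = a := exists_mk _
    obtain ⟨b, rfl⟩ : ∃ a', mk a' = b := exists_mk _
    obtain ⟨w, rfl⟩ : ∃ a', mk a' = w := exists_mk _
    have h := mk_eq (Rel.rel_two a b ts w (by simpa using hts))
    rw [mk_add] at h
    rw [eq_sub_iff_add_eq]
    simpa [mk_sum, ← applyOp_mk, ← List.map_take, ← List.map_drop] using h
  rel_three x ys z ts w hys hts := by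
    obtain ⟨ts, rfl⟩ : ∃ l' : List (Pre K X), l'.map mk = ts := exists_map_mk _
    obtain ⟨ys, rfl⟩ : ∃ l' : List (Pre K X), l'.map mk = ys := exists_map_mk _
    obtain ⟨x, rfl⟩ : ∃ a', mk a' = x := exists_mk _
    obtain ⟨z, rfl⟩ : ∃ a', mk a' = z := exists_mk _
    obtain ⟨w, rfl⟩ : ∃ a', mk a' = w := exists_mk _
    have h := mk_eq (Rel.rel_three x ys z ts w (by simpa using hys) (by simpa using hts))
    rw [mk_add, mk_add] at h
    rw [eq_sub_iff_add_eq]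
    simpa [mk_sum, ← applyOp_mk, ← List.map_take, ← List.map_drop] using h

/-- The generator attached to `x : X`. -/
def of (K : Type u) {X : Type v} [Field K] (x : X) : FreeNAlgebra K X := mk (.of x)

/-! #### Universal property -/

section lift

variable {A : Type w} [AddCommGroup A] [Module K A] [NAlgebra K A]

/-- Value of a formal expression in an `𝒩`-algebra. -/
def Pre.eval (φ : X → A) : Pre K X → A
  | .of x => φ x
  | .zero => 0
  | .add a b => Pre.eval φ a + Pre.eval φ b
  | .smul r a => r • Pre.eval φ a
  | .node n f => NAlgebra.N (K := K) n fun i => Pre.eval φ (f i)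

theorem Pre.eval_sum (φ : X → A) (m : ℕ) (g : ℕ → Pre K X) :
    (Pre.sum m g).eval φ = ∑ i ∈ Finset.range m, (g i).eval φ := by
  induction m with
  | zero => rfl
  | succ m ih => rw [Finset.sum_range_succ, ← ih]; rfl

theorem Pre.eval_op (φ : X → A) (l : List (Pre K X)) :
    (Pre.op l).eval φ =
      applyOp (fun n => (NAlgebra.N (K := K) (A := A) n : (Fin (n + 2) → A) → A))
        (l.map (Pre.eval φ)) := by
  match l with
  | [] => rfl
  | [_] => rfl
  | a :: b :: l =>
    have key : ∀ (n m : ℕ) (h : m = n) (f : Fin (m + 2) → A)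
        (g : Fin (n + 2) → A), (∀ i, f i = g (Fin.cast (by rw [h]) i)) →
        NAlgebra.N (K := K) n g = NAlgebra.N (K := K) m f := by
      rintro n m rfl f g hfg
      congr 1
      funext i
      exact (hfg i).symm
    exact key l.length (l.map (Pre.eval φ)).length (by simp) _ _
      (fun i => by
        change ((a :: b :: l).map (Pre.eval φ))[i.1]'_ = _
        rw [List.getElem_map]
        rfl)

theorem Pre.eval_update (φ : X → A) {n : ℕ} (f : Fin (n + 2) → Pre K X) (i : Fin (n + 2))
    (a : Pre K X) : (fun j => (Function.update f i a j).eval φ) =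
      Function.update (fun j => (f j).eval φ) i (a.eval φ) := by
  funext j
  rcases eq_or_ne j i with rfl | h
  · simp
  · simp [h]

theorem Pre.eval_eq (φ : X → A) {a b : Pre K X} (h : Rel a b) : a.eval φ = b.eval φ := by
  induction h with
  | refl a => rfl
  | symm _ ih => exact ih.symm
  | trans _ _ ih ih' => exact ih.trans ih'
  | add_congr _ _ ih ih' => simp only [Pre.eval, ih, ih']
  | smul_congr r _ ih => simp only [Pre.eval, ih]
  | node_congr n _ ih => simp only [Pre.eval, ih]
  | add_assoc a b c => simp only [Pre.eval, _root_.add_assoc]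
  | add_comm a b => simp only [Pre.eval]; exact _root_.add_comm _ _
  | zero_add a => simp only [Pre.eval, _root_.zero_add]
  | neg_add a => simp [Pre.eval]
  | smul_add r a b => simp only [Pre.eval, _root_.smul_add]
  | add_smul r s a => simp only [Pre.eval, _root_.add_smul]
  | mul_smul r s a => simp only [Pre.eval, SemigroupAction.mul_smul]
  | one_smul a => simp only [Pre.eval, _root_.one_smul]
  | node_add n f i a b => simp only [Pre.eval, Pre.eval_update, MultilinearMap.map_update_add]
  | node_smul n f i r a => simp only [Pre.eval, Pre.eval_update, MultilinearMap.map_update_smul]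
  | rel_one xs y z h =>
    have := NAlgebra.rel_one (K := K) (xs.map (Pre.eval φ)) (y.eval φ) (z.eval φ) (by simpa using h)
    simpa [Pre.eval_sum, Pre.eval_op, List.map_take, List.map_drop] using this
  | rel_two a b ts w h =>
    have := NAlgebra.rel_two (K := K) (a.eval φ) (b.eval φ) (ts.map (Pre.eval φ)) (w.eval φ)
      (by simpa using h)
    rw [eq_sub_iff_add_eq] at this
    simpa [Pre.eval, Pre.eval_sum, Pre.eval_op, List.map_take, List.map_drop] using this
  | rel_three x ys z ts w h h' =>
    have := NAlgebra.rel_three (K := K) (x.eval φ) (ys.map (Pre.eval φ)) (z.eval φ)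
      (ts.map (Pre.eval φ)) (w.eval φ) (by simpa using h) (by simpa using h')
    rw [eq_sub_iff_add_eq] at this
    simpa [Pre.eval, Pre.eval_sum, Pre.eval_op, List.map_take, List.map_drop] using this

/-- The morphism of `𝒩`-algebras from the free `𝒩`-algebra that extends `φ : X → A`. -/
def lift (φ : X → A) : FreeNAlgebra K X →ₗ[K] A where
  toFun := Quotient.lift (Pre.eval φ) fun _ _ h => Pre.eval_eq φ h
  map_add' := by rintro ⟨a⟩ ⟨b⟩; rfl
  map_smul' := by rintro r ⟨a⟩; rfl

@[simp] theorem lift_of (φ : X → A) (x : X) : lift φ (of K x) = φ x := rfl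

theorem lift_N (φ : X → A) (n : ℕ) (f : Fin (n + 2) → FreeNAlgebra K X) :
    lift φ (NAlgebra.N (K := K) n f) = NAlgebra.N (K := K) n fun i => lift φ (f i) := by
  obtain ⟨g, rfl⟩ : ∃ g : Fin (n + 2) → Pre K X, (fun i => mk (g i)) = f :=
    ⟨fun i => rep (f i), by simp⟩
  have h : NAlgebra.N (K := K) n (fun i => mk (g i)) = mk (.node n g) := nodeFun_mk n g
  rw [h]
  rfl

theorem hom_ext {f g : FreeNAlgebra K X →ₗ[K] A}
    (hf : ∀ n v, f (NAlgebra.N (K := K) n v) = NAlgebra.N (K := K) n fun i => f (v i))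
    (hg : ∀ n v, g (NAlgebra.N (K := K) n v) = NAlgebra.N (K := K) n fun i => g (v i))
    (h : ∀ x, f (of K x) = g (of K x)) : f = g := by
  have key : ∀ a : Pre K X, f (mk a) = g (mk a) := by
    intro a
    induction a with
    | of x => exact h x
    | zero => rw [mk_zero, map_zero, map_zero]
    | add a b iha ihb => rw [mk_add, map_add, map_add, iha, ihb]
    | smul r a ih => rw [mk_smul, map_smul, map_smul, ih]
    | node n v ih =>
      have e : NAlgebra.N (K := K) n (fun i => mk (v i)) = mk (.node n v) := nodeFun_mk n v
      rw [← e, hf, hg]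
      simp only [ih]
  ext a
  rw [← mk_rep a]
  exact key _

end lift

end FreeNAlgebra

/-! ### Monomials of the free `𝒩`-algebra -/

/-- Planar rooted trees with leaves labelled by `X`, all of whose inner vertices have at least two
children: the monomials that can be formed with one operation in each arity `≥ 2`. -/
inductive PTree (X : Type v) : Type v
  | leaf : X → PTree X
  | node : (n : ℕ) → (Fin (n + 2) → PTree X) → PTree X

namespace PTree

variable {X : Type v}

/-- The word of labels of the leaves, read from left to right. -/
def leaves : PTree X → List X
  | .leaf x => [x]
  | .node _ f => (List.ofFn fun i => leaves (f i)).flatten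

/-- The value of a monomial in an `𝒩`-algebra. -/
def eval (K : Type u) [Field K] {A : Type w} [AddCommGroup A] [Module K A] [NAlgebra K A]
    (φ : X → A) : PTree X → A
  | .leaf x => φ x
  | .node n f => NAlgebra.N (K := K) n fun i => eval K φ (f i)

end PTree

namespace FreeNAlgebra

variable {K : Type u} [Field K] {X : Type v}

theorem lift_eval {A : Type w} [AddCommGroup A] [Module K A] [NAlgebra K A] (φ : X → A)
    (t : PTree X) : lift φ (t.eval K (of K)) = t.eval K φ := by
  induction t with
  | leaf x => rfl
  | node n f ih => rw [PTree.eval, lift_N]; simp only [ih]; rfl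

variable (K) in
/-- The span of the monomials whose word of leaf labels lies in `C`. -/
def wordSpan (C : Set (List X)) : Submodule K (FreeNAlgebra K X) :=
  Submodule.span K {a | ∃ t : PTree X, t.leaves ∈ C ∧ t.eval K (of K) = a}

theorem multilinear_mem {ι : Type*} [Fintype ι] {M : Type v} {M' : Type w}
    [AddCommGroup M] [Module K M] [AddCommGroup M'] [Module K M']
    (f : MultilinearMap K (fun _ : ι => M) M') (s : ι → Set M) (P : Submodule K M')
    (h : ∀ b, (∀ i, b i ∈ s i) → f b ∈ P) (a : ι → M)
    (ha : ∀ i, a i ∈ Submodule.span K (s i)) : f a ∈ P := by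
  classical
  have key : ∀ (T : Finset ι) (b : ι → M), (∀ i ∈ T, b i ∈ Submodule.span K (s i)) →
      (∀ i ∉ T, b i ∈ s i) → f b ∈ P := by
    intro T
    induction T using Finset.induction_on with
    | empty => exact fun b _ hb => h b fun i => hb i (by simp)
    | insert i T hi ih =>
      intro b hb hb'
      have main : ∀ x ∈ Submodule.span K (s i), f (Function.update b i x) ∈ P := by
        intro x hx
        induction hx using Submodule.span_induction with
        | mem x hx =>
          apply ih
          · intro j hj
            have : j ≠ i := fun e => hi (e ▸ hj)
            rw [Function.update_of_ne this]
            exact hb j (Finset.mem_insert_of_mem hj)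
          · intro j hj
            rcases eq_or_ne j i with rfl | hji
            · simpa using hx
            · rw [Function.update_of_ne hji]
              exact hb' j (by simp [hj, hji])
        | zero => rw [f.map_update_zero]; exact P.zero_mem
        | add x y _ _ hx hy => rw [f.map_update_add]; exact P.add_mem hx hy
        | smul r x _ hx => rw [f.map_update_smul]; exact P.smul_mem r hx
      have := main (b i) (hb i (Finset.mem_insert_self i T))
      rwa [Function.update_eq_self] at this
  exact key Finset.univ a (fun i _ => ha i) (fun i hi => absurd (Finset.mem_univ i) hi)

theorem wordSpan_mono {C D : Set (List X)} (h : C ⊆ D) : wordSpan K C ≤ wordSpan K D :=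
  Submodule.span_mono fun _ ⟨t, ht, e⟩ => ⟨t, h ht, e⟩

theorem N_mem_wordSpan {n : ℕ} (a : Fin (n + 2) → FreeNAlgebra K X)
    (C : Fin (n + 2) → Set (List X)) (ha : ∀ i, a i ∈ wordSpan K (C i)) (D : Set (List X))
    (hD : ∀ l : Fin (n + 2) → List X, (∀ i, l i ∈ C i) → (List.ofFn l).flatten ∈ D) :
    NAlgebra.N (K := K) n a ∈ wordSpan K D := by
  refine multilinear_mem (NAlgebra.N (K := K) n) _ _ ?_ a ha
  intro b hb
  choose t ht e using hb
  obtain rfl : (fun i => (t i).eval K (of K)) = b := funext e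
  exact Submodule.subset_span ⟨.node n t, hD _ ht, rfl⟩

/-- Words obtained from a word by substituting for each letter `x` a word in `D x`. -/
def substWords {Y : Type w} (D : X → Set (List Y)) (L : List X) : Set (List Y) :=
  {m | ∃ ls, List.Forall₂ (fun x l => l ∈ D x) L ls ∧ ls.flatten = m}

theorem eval_mem_wordSpan {Y : Type w} (φ : X → FreeNAlgebra K Y) (D : X → Set (List Y))
    (h : ∀ x, φ x ∈ wordSpan K (D x)) (t : PTree X) :
    t.eval K φ ∈ wordSpan K (substWords D t.leaves) := by
  induction t with
  | leaf x =>
    have hs : D x ⊆ substWords D (PTree.leaf x).leaves :=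
      fun l hl => ⟨[l], .cons hl .nil, by simp⟩
    exact wordSpan_mono hs (h x)
  | node n f ih =>
    refine N_mem_wordSpan _ _ ih _ fun l hl => ?_
    choose ls hls e using hl
    refine ⟨(List.ofFn ls).flatten, ?_, ?_⟩
    · refine List.rel_flatten ?_
      rw [List.forall₂_iff_get]
      refine ⟨by simp, fun i h₁ h₂ => ?_⟩
      simp only [List.get_eq_getElem, List.getElem_ofFn]
      exact hls _
    · rw [List.flatten_flatten, List.map_ofFn]
      congr 2
      exact funext e

theorem lift_mem_wordSpan {Y : Type w} (φ : X → FreeNAlgebra K Y) (D : X → Set (List Y))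
    (h : ∀ x, φ x ∈ wordSpan K (D x)) (C : Set (List X)) (C' : Set (List Y))
    (hC : ∀ L ∈ C, substWords D L ⊆ C') {p : FreeNAlgebra K X} (hp : p ∈ wordSpan K C) :
    lift φ p ∈ wordSpan K C' := by
  induction hp using Submodule.span_induction with
  | mem x hx =>
    obtain ⟨t, ht, rfl⟩ := hx
    rw [lift_eval]
    exact wordSpan_mono (hC _ ht) (eval_mem_wordSpan φ D h t)
  | zero => rw [map_zero]; exact Submodule.zero_mem _
  | add x y _ _ hx hy => rw [map_add]; exact Submodule.add_mem _ hx hy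
  | smul r x _ hx => rw [map_smul]; exact Submodule.smul_mem _ r hx

/-- The renaming of variables along `g`. -/
noncomputable def rename {Y : Type w} (g : X → Y) : FreeNAlgebra K X →ₗ[K] FreeNAlgebra K Y :=
  lift fun x => of K (g x)

theorem rename_mem_wordSpan {Y : Type w} (g : X → Y) (C : Set (List X)) (C' : Set (List Y))
    (h : ∀ L ∈ C, L.map g ∈ C') {p : FreeNAlgebra K X} (hp : p ∈ wordSpan K C) :
    rename g p ∈ wordSpan K C' := by
  refine lift_mem_wordSpan _ (fun x => {[g x]})
    (fun x => Submodule.subset_span ⟨.leaf (g x), rfl, rfl⟩) C C' ?_ hp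
  rintro L hL _ ⟨ls, hls, rfl⟩
  convert h L hL
  clear hL
  induction hls with
  | nil => rfl
  | cons h₁ _ ih => rw [List.flatten_cons, ih, Set.mem_singleton_iff.1 h₁]; rfl

theorem lift_lift {Y : Type w} {A : Type*} [AddCommGroup A] [Module K A] [NAlgebra K A]
    (φ : X → FreeNAlgebra K Y) (ψ : Y → A) (p : FreeNAlgebra K X) :
    lift ψ (lift φ p) = lift (fun x => lift ψ (φ x)) p := by
  have : (lift ψ).comp (lift φ) = lift (fun x => lift ψ (φ x)) := by
    refine hom_ext (fun n v => ?_) (fun n v => lift_N _ n v) fun x => rfl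
    rw [LinearMap.comp_apply, lift_N, lift_N]
    rfl
  exact LinearMap.congr_fun this p

theorem lift_of_eq (p : FreeNAlgebra K X) : lift (of K) p = p := by
  have : lift (of K) = (LinearMap.id : FreeNAlgebra K X →ₗ[K] _) :=
    hom_ext (fun n v => lift_N _ n v) (fun n v => rfl) fun x => rfl
  exact LinearMap.congr_fun this p

theorem eval_congr {A : Type w} [AddCommGroup A] [Module K A] [NAlgebra K A] (t : PTree X)
    {φ ψ : X → A} (h : ∀ x ∈ t.leaves, φ x = ψ x) : t.eval K φ = t.eval K ψ := by
  induction t with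
  | leaf x => exact h x (by simp [PTree.leaves])
  | node n f ih =>
    simp only [PTree.eval]
    congr 1
    funext i
    refine ih i fun x hx => h x ?_
    rw [PTree.leaves, List.mem_flatten]
    exact ⟨_, (List.mem_ofFn' _ _).2 ⟨i, rfl⟩, hx⟩

/-- The set of words in which each letter of `X` occurs exactly once. -/
def linearWords (X : Type v) : Set (List X) := {l | l.Nodup ∧ ∀ x, x ∈ l}

end FreeNAlgebra

/-! ### Symmetric operads -/

/-- A symmetric operad in `K`-vector spaces, in coordinate-free form: a functor from finite sets and
bijections to vector spaces, with a unit and a composition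
`P(S) ⊗ ⨂_{s ∈ S} P(T s) → P(⨆_{s ∈ S} T s)`, natural, associative and unital.
The component of arity `n` is `obj (Fin n)`, on which `Sₙ` acts through `map`. -/
structure SymmetricOperad (K : Type u) [Field K] where
  obj : (S : Type) → [Finite S] → Type v
  [addCommGroup : ∀ (S : Type) [Finite S], AddCommGroup (obj S)]
  [module : ∀ (S : Type) [Finite S], Module K (obj S)]
  map : ∀ {S T : Type} [Finite S] [Finite T], S ≃ T → obj S →ₗ[K] obj T
  map_refl : ∀ {S : Type} [Finite S] (p : obj S), map (Equiv.refl S) p = p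
  map_trans : ∀ {S T U : Type} [Finite S] [Finite T] [Finite U] (e : S ≃ T) (f : T ≃ U)
    (p : obj S), map (e.trans f) p = map f (map e p)
  one : obj Unit
  comp : ∀ {S : Type} {T : S → Type} [Finite S] [∀ s, Finite (T s)],
    obj S →ₗ[K] MultilinearMap K (fun s => obj (T s)) (obj (Σ s, T s))
  comp_map_left : ∀ {S S' : Type} {T : S' → Type} [Finite S] [Finite S'] [∀ s, Finite (T s)]
    (e : S ≃ S') (p : obj S) (q : ∀ s, obj (T s)),
    comp (map e p) q = map (Equiv.sigmaCongrLeft e) (comp p fun s => q (e s))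
  comp_map_right : ∀ {S : Type} {T T' : S → Type} [Finite S] [∀ s, Finite (T s)]
    [∀ s, Finite (T' s)] (f : ∀ s, T s ≃ T' s) (p : obj S) (q : ∀ s, obj (T s)),
    comp p (fun s => map (f s) (q s)) = map (Equiv.sigmaCongrRight f) (comp p q)
  comp_assoc : ∀ {S : Type} {T : S → Type} {U : ∀ s, T s → Type} [Finite S] [∀ s, Finite (T s)]
    [∀ s t, Finite (U s t)] (p : obj S) (q : ∀ s, obj (T s)) (r : ∀ s t, obj (U s t)),
    map (Equiv.sigmaAssoc U) (comp (comp p q) fun x : Σ s, T s => r x.1 x.2) =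
      comp p fun s => comp (q s) (r s)
  one_comp : ∀ {T : Unit → Type} [∀ s, Finite (T s)] (q : ∀ s, obj (T s)),
    map (Equiv.uniqueSigma T) (comp one q) = q default
  comp_one : ∀ {S : Type} [Finite S] (p : obj S),
    map (Equiv.sigmaUnique S fun _ => Unit) (comp p fun _ => one) = p

namespace SymmetricOperad

variable {K : Type u} [Field K]

instance (P : SymmetricOperad.{u, v} K) (S : Type) [Finite S] : AddCommGroup (P.obj S) :=
  P.addCommGroup S

instance (P : SymmetricOperad.{u, v} K) (S : Type) [Finite S] : Module K (P.obj S) := P.module S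

/-- The action of the symmetric group `Sₙ` on the component `P(n)`. -/
def symmAction (P : SymmetricOperad.{u, v} K) (n : ℕ) :
    Representation K (Equiv.Perm (Fin n)) (P.obj (Fin n)) where
  toFun σ := P.map σ
  map_one' := LinearMap.ext fun p => P.map_refl p
  map_mul' σ τ := LinearMap.ext fun p => P.map_trans τ σ p

/-- A family of subspaces `Qₙ ⊆ P(n)` that is a non-symmetric operad for the composition of `P`:
it contains the unit and is closed under the composition
`Q_k ⊗ Q_{n₁} ⊗ ⋯ ⊗ Q_{n_k} → Q_{n₁ + ⋯ + n_k}` in which the inputs are numbered from left to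
right. It need not be stable under the symmetric groups. -/
structure NonSymmetricSuboperad (P : SymmetricOperad.{u, v} K) where
  carrier : (n : ℕ) → Submodule K (P.obj (Fin n))
  one_mem : P.map (Equiv.ofUnique Unit (Fin 1)) P.one ∈ carrier 1
  comp_mem : ∀ {k : ℕ} (n : Fin k → ℕ) (p : P.obj (Fin k)) (q : ∀ i, P.obj (Fin (n i))),
    p ∈ carrier k → (∀ i, q i ∈ carrier (n i)) →
      P.map finSigmaFinEquiv (P.comp p q) ∈ carrier (∑ i, n i)

/-- The `Sₙ`-equivariant map `Qₙ ⊗ K[Sₙ] → P(n)`, `q ⊗ σ ↦ σ · q`. -/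
noncomputable def NonSymmetricSuboperad.symmetrization {P : SymmetricOperad.{u, v} K}
    (Q : P.NonSymmetricSuboperad) (n : ℕ) :
    Q.carrier n ⊗[K] MonoidAlgebra K (Equiv.Perm (Fin n)) →ₗ[K] P.obj (Fin n) :=
  TensorProduct.lift ((P.symmAction n).asAlgebraHom.toLinearMap.flip ∘ₗ (Q.carrier n).subtype)

/-- `P` is the symmetrization of the non-symmetric operad `Q`: for every `n`, the map
`Qₙ ⊗ K[Sₙ] → P(n)` is an isomorphism. (The composition of `P` is then determined by that of `Q`
and equivariance.) -/
def NonSymmetricSuboperad.IsNonSymmetricForm {P : SymmetricOperad.{u, v} K}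
    (Q : P.NonSymmetricSuboperad) : Prop :=
  ∀ n, Function.Bijective (Q.symmetrization n)

/-- A regular (non-symmetric) operad: the symmetrization of a non-symmetric operad. -/
def IsRegular (P : SymmetricOperad.{u, v} K) : Prop :=
  ∃ Q : P.NonSymmetricSuboperad, Q.IsNonSymmetricForm

end SymmetricOperad

/-! ### The operad of `𝒩`-algebras -/

namespace FreeNAlgebra

variable {K : Type u} [Field K]

variable (K) in
/-- The multilinear part of the free `𝒩`-algebra on `S`: the span of the monomials in which each
variable occurs exactly once. -/
def multilinearPart (S : Type) : Submodule K (FreeNAlgebra K S) := wordSpan K (linearWords S)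

theorem rename_mem_multilinearPart {S T : Type} (e : S ≃ T) {p : FreeNAlgebra K S}
    (hp : p ∈ multilinearPart K S) : rename e p ∈ multilinearPart K T :=
  rename_mem_wordSpan e (linearWords S) (linearWords T) (fun L hL => ⟨hL.1.map e.injective,
    fun x => List.mem_map.2 ⟨e.symm x, hL.2 _, e.apply_symm_apply x⟩⟩) hp

theorem substWords_linear {S : Type} {T : S → Type} (L : List S) (hL : L ∈ linearWords S) :
    substWords (fun s => (List.map (Sigma.mk s)) '' linearWords (T s)) L ⊆
      linearWords (Σ s, T s) := by
  rintro _ ⟨ls, hls, rfl⟩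
  have key : ls.flatten.Nodup ∧ ∀ x : Σ s, T s, x ∈ ls.flatten ↔ x.1 ∈ L := by
    replace hL := hL.1
    induction hls with
    | nil => simp
    | @cons s l L ls h _ ih =>
      obtain ⟨hs, hL⟩ := List.nodup_cons.1 hL
      obtain ⟨h₁, h₂⟩ := ih hL
      obtain ⟨m, hm, rfl⟩ := h
      refine ⟨?_, ?_⟩
      · rw [List.flatten_cons, List.nodup_append']
        refine ⟨hm.1.map sigma_mk_injective, h₁, ?_⟩
        intro x hx hx'
        obtain ⟨t, _, rfl⟩ := List.mem_map.1 hx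
        exact hs ((h₂ _).1 hx')
      · rintro ⟨s', t⟩
        rw [List.flatten_cons, List.mem_append, h₂, List.mem_cons]
        refine or_congr ?_ Iff.rfl
        constructor
        · intro h
          obtain ⟨t, _, e⟩ := List.mem_map.1 h
          exact (congrArg Sigma.fst e).symm
        · rintro rfl
          exact List.mem_map_of_mem (hm.2 t)
  exact ⟨key.1, fun x => (key.2 x).2 (hL.2 _)⟩

/-- Substitution of `q s` for the variable `s` in `p`, with the variables of the different `q s`
made distinct. -/
noncomputable def subst {S : Type} {T : S → Type} (p : FreeNAlgebra K S)
    (q : ∀ s, FreeNAlgebra K (T s)) : FreeNAlgebra K (Σ s, T s) :=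
  lift (fun s => rename (Sigma.mk s) (q s)) p

theorem subst_mem {S : Type} {T : S → Type} {p : FreeNAlgebra K S}
    (hp : p ∈ multilinearPart K S) {q : ∀ s, FreeNAlgebra K (T s)}
    (hq : ∀ s, q s ∈ multilinearPart K (T s)) : subst p q ∈ multilinearPart K (Σ s, T s) :=
  lift_mem_wordSpan _ _
    (fun s => rename_mem_wordSpan _ _ _ (fun _ hL => Set.mem_image_of_mem _ hL) (hq s))
    _ _ substWords_linear hp

section multilinear

variable {A : Type w} [AddCommGroup A] [Module K A] [NAlgebra K A] {X : Type v} [DecidableEq X]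

theorem eval_update_of_notMem (t : PTree X) (φ : X → A) {x : X} (hx : x ∉ t.leaves) (a : A) :
    t.eval K (Function.update φ x a) = t.eval K φ :=
  eval_congr t fun y hy => Function.update_of_ne (ne_of_mem_of_not_mem hy hx) _ _

/-- A monomial in which `x` occurs exactly once is linear in `x`. -/
theorem exists_linear (t : PTree X) (φ : X → A) {x : X} (hn : t.leaves.Nodup)
    (hx : x ∈ t.leaves) : ∃ f : A →ₗ[K] A, ∀ a, t.eval K (Function.update φ x a) = f a := by
  induction t with
  | leaf y =>
    obtain rfl : x = y := by simpa [PTree.leaves] using hx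
    exact ⟨LinearMap.id, fun a => by simp [PTree.eval]⟩
  | node n f ih =>
    rw [PTree.leaves, List.nodup_flatten] at hn
    rw [PTree.leaves, List.mem_flatten] at hx
    obtain ⟨_, hl, hx⟩ := hx
    obtain ⟨i, rfl⟩ := (List.mem_ofFn' _ _).1 hl
    obtain ⟨g, hg⟩ := ih i (hn.1 _ hl) hx
    have hj : ∀ j ≠ i, x ∉ (f j).leaves := by
      have hp := List.pairwise_ofFn.1 hn.2
      intro j hji hxj
      rcases lt_or_gt_of_ne hji with h | h
      · exact hp h hxj hx
      · exact hp h hx hxj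
    refine ⟨((NAlgebra.N (K := K) n).toLinearMap (fun j => (f j).eval K φ) i).comp g,
      fun a => ?_⟩
    rw [LinearMap.comp_apply, MultilinearMap.toLinearMap_apply, ← hg a, PTree.eval]
    congr 1
    funext j
    rcases eq_or_ne j i with rfl | hji
    · simp
    · rw [Function.update_of_ne hji]
      exact eval_update_of_notMem _ _ (hj j hji) a

end multilinear

theorem exists_linear_lift {A : Type w} [AddCommGroup A] [Module K A] [NAlgebra K A] {S : Type}
    [DecidableEq S] {p : FreeNAlgebra K S} (hp : p ∈ multilinearPart K S) (φ : S → A) (s : S) :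
    ∃ f : A →ₗ[K] A, ∀ a, lift (Function.update φ s a) p = f a := by
  induction hp using Submodule.span_induction with
  | mem x hx =>
    obtain ⟨t, ht, rfl⟩ := hx
    simp only [lift_eval]
    exact exists_linear t φ ht.1 (ht.2 s)
  | zero => exact ⟨0, fun a => by simp⟩
  | add x y _ _ hx hy =>
    obtain ⟨f, hf⟩ := hx
    obtain ⟨g, hg⟩ := hy
    exact ⟨f + g, fun a => by simp [hf, hg]⟩
  | smul r x _ hx =>
    obtain ⟨f, hf⟩ := hx
    exact ⟨r • f, fun a => by simp [hf]⟩

theorem update_rename {S : Type} [DecidableEq S] {T : S → Type}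
    (q : ∀ s, multilinearPart K (T s)) (s : S) (a : multilinearPart K (T s)) :
    (fun s' => rename (K := K) (Sigma.mk s') (Function.update q s a s').1) =
      Function.update (fun s' => rename (Sigma.mk s') (q s').1) s (rename (Sigma.mk s) a.1) := by
  funext s'
  rcases eq_or_ne s' s with rfl | h
  · simp
  · simp [h]

/-- Operadic composition on the multilinear parts. -/
noncomputable def multilinearComp {S : Type} {T : S → Type} :
    multilinearPart K S →ₗ[K] MultilinearMap K (fun s => multilinearPart K (T s))
      (multilinearPart K (Σ s, T s)) where
  toFun p :=
    { toFun := fun q => ⟨subst p.1 fun s => (q s).1, subst_mem p.2 fun s => (q s).2⟩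
      map_update_add' := by
        intro _ q s a b
        refine Subtype.ext ?_
        obtain ⟨f, hf⟩ :=
          exists_linear_lift p.2 (fun s' => rename (K := K) (Sigma.mk s') (q s').1) s
        change lift _ _ = lift _ _ + lift _ _
        rw [update_rename, update_rename, update_rename, hf, hf, hf, ← map_add, ← map_add]
        rfl
      map_update_smul' := by
        intro _ q s r a
        refine Subtype.ext ?_
        obtain ⟨f, hf⟩ :=
          exists_linear_lift p.2 (fun s' => rename (K := K) (Sigma.mk s') (q s').1) s
        change lift _ _ = r • lift _ _
        rw [update_rename, update_rename, hf, hf, ← map_smul, ← map_smul]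
        rfl }
  map_add' p p' := by
    refine MultilinearMap.ext fun q => Subtype.ext ?_
    exact map_add (lift _) _ _
  map_smul' r p := by
    refine MultilinearMap.ext fun q => Subtype.ext ?_
    exact map_smul (lift _) _ _

end FreeNAlgebra

open FreeNAlgebra in
/-- The operad `𝒩` of `𝒩`-algebras: `𝒩(S)` is the multilinear part of the free `𝒩`-algebra on `S`,
bijections act by renaming of variables, and composition is substitution. -/
noncomputable def NOperad (K : Type u) [Field K] : SymmetricOperad.{u, u} K where
  obj S _ := multilinearPart K S
  map e := (rename e).restrict fun _ hp => rename_mem_multilinearPart e hp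
  map_refl p := Subtype.ext (lift_of_eq p.1)
  map_trans e f p :=
    Subtype.ext (lift_lift (fun x => of K (e x)) (fun x => of K (f x)) p.1).symm
  one := ⟨of K (), Submodule.subset_span ⟨.leaf (), ⟨by simp [PTree.leaves],
    fun x => by simp [PTree.leaves]⟩, rfl⟩⟩
  comp := multilinearComp
  comp_map_left := by
    intro S S' T _ _ _ e p q
    refine Subtype.ext ?_
    change lift _ (lift _ p.1) = lift _ (lift _ p.1)
    rw [lift_lift, lift_lift]
    congr 2
    funext s
    rw [lift_of]
    change lift _ _ = lift _ (lift _ _)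
    rw [lift_lift]
    rfl
  comp_map_right := by
    intro S T T' _ _ _ f p q
    refine Subtype.ext ?_
    change lift _ p.1 = lift _ (lift _ p.1)
    rw [lift_lift]
    congr 2
    funext s
    change lift _ (lift _ _) = lift _ (lift _ _)
    rw [lift_lift, lift_lift]
    rfl
  comp_assoc := by
    intro S T U _ _ _ p q r
    refine Subtype.ext ?_
    change lift _ (lift _ (lift _ p.1)) = lift _ p.1
    rw [lift_lift, lift_lift]
    congr 2
    funext s
    change lift _ (lift _ _) = lift _ (lift _ _)
    rw [lift_lift, lift_lift]
    congr 2
    funext t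
    change lift _ (lift _ _) = lift _ (lift _ _)
    rw [lift_lift, lift_lift]
    rfl
  one_comp := by
    intro T _ q
    refine Subtype.ext ?_
    change lift _ (lift _ (q ()).1) = (q ()).1
    rw [lift_lift]
    exact lift_of_eq _
  comp_one := by
    intro S _ p
    refine Subtype.ext ?_
    change lift _ (lift _ p.1) = p.1
    rw [lift_lift]
    exact lift_of_eq _

namespace FreeNAlgebra

theorem flatten_range_sum (k : ℕ) (n : ℕ → ℕ) :
    ((List.range k).map fun i => (List.range (n i)).map fun j =>
      (∑ i' ∈ Finset.range i, n i') + j).flatten = List.range (∑ i ∈ Finset.range k, n i) := by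
  induction k with
  | zero => simp
  | succ k ih =>
    rw [List.range_succ, List.map_append, List.flatten_append, ih, Finset.sum_range_succ,
      List.range_add]
    simp

theorem flatten_finRange {k : ℕ} (n : Fin k → ℕ) :
    (((List.finRange k).map fun i => (List.finRange (n i)).map (Sigma.mk i)).flatten).map
      finSigmaFinEquiv = List.finRange (∑ i, n i) := by
  apply List.map_injective_iff.2 Fin.val_injective
  let n' : ℕ → ℕ := fun i => if h : i < k then n ⟨i, h⟩ else 0
  have hn' : ∀ i : Fin k, n' i = n i := fun i => by simp [n']
  have hs : ∑ i, n i = ∑ i ∈ Finset.range k, n' i := by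
    rw [Finset.sum_range]
    exact Finset.sum_congr rfl fun i _ => (hn' i).symm
  refine Eq.trans ?_ ((flatten_range_sum k n').trans
    ((congrArg List.range hs.symm).trans (List.map_coe_finRange_eq_range).symm))
  rw [List.map_flatten, List.map_flatten, ← List.map_coe_finRange_eq_range, List.map_map, List.map_map, List.map_map]
  congr 1
  refine List.map_congr_left fun i _ => ?_
  simp only [Function.comp_apply, List.map_map]
  rw [hn', ← List.map_coe_finRange_eq_range, List.map_map]
  refine List.map_congr_left fun j _ => ?_
  simp only [Function.comp_apply, finSigmaFinEquiv_apply]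
  congr 1
  rw [Finset.sum_range]
  exact Finset.sum_congr rfl fun i' _ => (hn' (Fin.castLE i.2.le i')).symm

end FreeNAlgebra

open FreeNAlgebra in
/-- The non-symmetric operad `(𝒩ₙ)`: `𝒩ₙ` is the span, in `𝒩(n)`, of the monomials in which the
variables `0, 1, …, n - 1` occur in this order, once each. -/
noncomputable def NOperad.planar (K : Type u) [Field K] :
    (NOperad K).NonSymmetricSuboperad where
  carrier n := (wordSpan K {List.finRange n}).comap (multilinearPart K (Fin n)).subtype
  one_mem := Submodule.subset_span ⟨.leaf 0, rfl, rfl⟩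
  comp_mem := by
    intro k n p q hp hq
    refine rename_mem_wordSpan finSigmaFinEquiv
      {((List.finRange k).map fun i => (List.finRange (n i)).map (Sigma.mk i)).flatten} _ ?_
      (lift_mem_wordSpan _ (fun i => {(List.finRange (n i)).map (Sigma.mk i)})
        (fun i => rename_mem_wordSpan _ {List.finRange (n i)} _ ?_ (hq i))
        {List.finRange k} _ ?_ hp)
    · rintro _ rfl
      exact flatten_finRange n
    · rintro _ rfl
      rfl
    · rintro _ rfl _ ⟨ls, hls, rfl⟩
      refine congrArg List.flatten ?_
      generalize List.finRange k = L at hls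
      induction hls with
      | nil => rfl
      | cons h _ ih => rw [ih, Set.mem_singleton_iff.1 h]; rfl

/-!
The relations of an `𝒩`-algebra rewrite every monomial `N(a₁, …, a_p, N(c₁, …, c_q, w))` whose last
argument is not a variable. The monomials left over are those all of whose inner vertices have a
leaf as their last child. Writing the monomial `N(d₁, …, d_p, x)` as `d₁ (d₂ (⋯ (d_p x)))`
identifies them with the planar binary trees, that is, with the elements of the free magma, and
the number of planar binary trees with `n` leaves is the Catalan number `c_{n-1}`. So everything
follows once the operations are known to extend to the span `F` of the planar binary trees
(`instNAlgebraTrees`), with `F` as the free `𝒩`-algebra (`freeEquiv`).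

Let `T` be the tensor algebra of `F`, and put `N(f) = f`. The three families of relations have a
common form, `N(a, N(c, w)) = N(a * c, w)`, for a bilinear product on the span of the nonempty words
of `T`, the insertion product:
`a * c = (∑ a' N(a'' c₁)) c₂ ⋯ c_q - a ∑ N(c') c''`,
where the sums are over all decompositions `a = a' a''`, and `c = c' c''` with `c'` nonempty. On the
span of trees this forces `N(a, d₁ (⋯ (d_p x))) = (a * d)(x)` for `d = d₁ ⋯ d_p` with `p ≥ 1`, where
a word acts on trees by iterated left multiplication. The right side involves only operations whose
last argument is one of the `d_i`, so this is a definition by recursion on the last argument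
(`opAux`). The relations then say that the insertion product is associative: for
`w = d₁ (⋯ (d_p x))`, the elements `N(a, N(c, w))` and `N(a * c, w)` are obtained by applying
`a * (c * d)` and `(a * c) * d` to `x`.

Associativity (`ins_assoc`) uses only the relations with last argument one of the `d_i`, so both
facts are proved together by induction. By the recursion `a * (c w) = (a * c) w - a N(c w)` on the
last letter it reduces to a word `d` of one letter; by recursion on the first letter of `a` it
reduces to the empty word `a`. There it says that `L(c) = ∑ N(c') c''` satisfies
`L(c * d) = L(c) * d` (`prefixSum_ins_letter`).

Conversely, the monomials attached to trees span: the linear map from `F` to the free `𝒩`-algebra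
is a morphism (`toFree_N`), as the operations of `F` are computed by the relations. All the maps
respect the words of leaf labels, so the trees with leaf word `0, 1, …, n - 1` give a basis of `𝒩ₙ`,
and the relabelings of these trees give one of `𝒩(n)`. The dimension of any other non-symmetric form
is obtained by dividing `dim 𝒩(n)` by `n!`.
-/

namespace NModel

/-! ### The insertion product on words -/

section insertion

variable {K : Type u} [Field K] {M : Type v} {V : Type w} [AddCommGroup V] [Module K V]

/-- The linear map that takes given values on the basis `M` of `K[M]`. -/
noncomputable def extend (f : M → V) : MonoidAlgebra K M →ₗ[K] V :=
  (MonoidAlgebra.basis M K).constr K f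

@[simp] theorem extend_single (f : M → V) (m : M) :
    extend (K := K) f (MonoidAlgebra.single m 1) = f m := by
  rw [extend, ← MonoidAlgebra.basis_apply, Module.Basis.constr_basis]

theorem extend_ext {f g : MonoidAlgebra K M →ₗ[K] V}
    (h : ∀ m, f (MonoidAlgebra.single m 1) = g (MonoidAlgebra.single m 1)) : f = g :=
  (MonoidAlgebra.basis M K).ext fun m => by simpa using h m

/-- The tensor algebra of the vector space `K[M]`, with the words in `M` as a basis. -/
abbrev Words (K : Type u) [Field K] (M : Type v) := MonoidAlgebra K (FreeMonoid M)

/-- A word, as an element of the tensor algebra. -/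
noncomputable def word (K : Type u) [Field K] {M : Type v} (l : List M) : Words K M :=
  MonoidAlgebra.single (FreeMonoid.ofList l) 1

/-- The inclusion of the space of letters in the tensor algebra. -/
noncomputable def letter : MonoidAlgebra K M →ₗ[K] Words K M := extend fun m => word K [m]

theorem word_nil : word K ([] : List M) = 1 := rfl

theorem word_append (l l' : List M) : word K (l ++ l') = word K l * word K l' := by
  rw [word, word, word, MonoidAlgebra.single_mul_single, one_mul]; rfl

theorem letter_single (m : M) : letter (K := K) (MonoidAlgebra.single m 1) = word K [m] :=
  extend_single _ _

theorem word_cons (m : M) (l : List M) :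
    word K (m :: l) = letter (MonoidAlgebra.single m 1) * word K l := by
  rw [letter_single, ← word_append]; rfl

theorem word_concat (l : List M) (m : M) :
    word K (l ++ [m]) = word K l * letter (MonoidAlgebra.single m 1) := by
  rw [letter_single, ← word_append]

@[elab_as_elim]
theorem single_induction {P : MonoidAlgebra K M → Prop} (x : MonoidAlgebra K M) (zero : P 0)
    (add : ∀ x y, P x → P y → P (x + y)) (smul : ∀ (r : K) x, P x → P (r • x))
    (single : ∀ m, P (MonoidAlgebra.single m 1)) : P x :=
  MonoidAlgebra.induction_linear x zero add fun m r => by simpa using smul r _ (single m)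

@[elab_as_elim]
theorem word_induction {P : Words K M → Prop} (x : Words K M) (zero : P 0)
    (add : ∀ x y, P x → P y → P (x + y)) (smul : ∀ (r : K) x, P x → P (r • x))
    (word : ∀ l, P (word K l)) : P x :=
  single_induction x zero add smul word

/-- The span of the nonempty words. -/
noncomputable def positive (K : Type u) [Field K] (M : Type v) : Submodule K (Words K M) :=
  Submodule.span K (Set.range fun p : M × List M => word K (p.1 :: p.2))

@[elab_as_elim]
theorem positive_induction {P : ∀ x : Words K M, x ∈ positive K M → Prop} {x : Words K M}
    (hx : x ∈ positive K M) (zero : P 0 (Submodule.zero_mem _))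
    (add : ∀ x y hx hy, P x hx → P y hy → P (x + y) (Submodule.add_mem _ hx hy))
    (smul : ∀ (r : K) x hx, P x hx → P (r • x) (Submodule.smul_mem _ r hx))
    (word : ∀ m l, P (word K (m :: l)) (Submodule.subset_span ⟨(m, l), rfl⟩)) : P x hx :=
  Submodule.span_induction (by rintro _ ⟨p, rfl⟩; exact word _ _) zero add smul hx

theorem word_mem_positive {l : List M} (h : l ≠ []) : word K l ∈ positive K M := by
  obtain ⟨m, l, rfl⟩ := List.exists_cons_of_ne_nil h
  exact Submodule.subset_span ⟨(m, l), rfl⟩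

theorem mul_mem_positive_left {x : Words K M} (hx : x ∈ positive K M) (y : Words K M) :
    x * y ∈ positive K M := by
  induction hx using positive_induction with
  | zero => simp
  | add x x' _ _ hx hx' => rw [add_mul]; exact add_mem hx hx'
  | smul r x _ hx => rw [smul_mul_assoc]; exact Submodule.smul_mem _ _ hx
  | word m l =>
    induction y using word_induction with
    | zero => simp
    | add x x' hx hx' => rw [mul_add]; exact add_mem hx hx'
    | smul r x hx => rw [mul_smul_comm]; exact Submodule.smul_mem _ _ hx
    | word l' => rw [← word_append]; exact word_mem_positive (by simp)

theorem mul_mem_positive_right (y : Words K M) {x : Words K M} (hx : x ∈ positive K M) :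
    y * x ∈ positive K M := by
  induction hx using positive_induction with
  | zero => simp
  | add x x' _ _ hx hx' => rw [mul_add]; exact add_mem hx hx'
  | smul r x _ hx => rw [mul_smul_comm]; exact Submodule.smul_mem _ _ hx
  | word m l =>
    induction y using word_induction with
    | zero => simp
    | add x x' hx hx' => rw [add_mul]; exact add_mem hx hx'
    | smul r x hx => rw [smul_mul_assoc]; exact Submodule.smul_mem _ _ hx
    | word l' => rw [← word_append]; exact word_mem_positive (by simp)

theorem letter_mem_positive (f : MonoidAlgebra K M) : letter f ∈ positive K M := by
  induction f using single_induction with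
  | zero => simp
  | add x x' hx hx' => rw [map_add]; exact add_mem hx hx'
  | smul r x hx => rw [map_smul]; exact Submodule.smul_mem _ _ hx
  | single m => rw [letter_single]; exact word_mem_positive (by simp)

variable (N : Words K M →ₗ[K] MonoidAlgebra K M)

/-- The sum of `N(c') c''` over the decompositions `c = c' c''` with `c'` nonempty. -/
noncomputable def prefixSum : Words K M →ₗ[K] Words K M :=
  extend fun c : FreeMonoid M => ∑ j ∈ Finset.range c.toList.length,
    letter (N (word K (c.toList.take (j + 1)))) * word K (c.toList.drop (j + 1))

/-- The sum of `c' N(c'')` over the decompositions `c = c' c''` with `c''` nonempty. -/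
noncomputable def suffixSum : Words K M →ₗ[K] Words K M :=
  extend fun c : FreeMonoid M => ∑ j ∈ Finset.range c.toList.length,
    word K (c.toList.take j) * letter (N (word K (c.toList.drop j)))

theorem prefixSum_word (c : List M) : prefixSum N (word K c) =
    ∑ j ∈ Finset.range c.length, letter (N (word K (c.take (j + 1)))) * word K (c.drop (j + 1)) :=
  extend_single _ _

theorem suffixSum_word (c : List M) : suffixSum N (word K c) =
    ∑ j ∈ Finset.range c.length, word K (c.take j) * letter (N (word K (c.drop j))) :=
  extend_single _ _

@[simp] theorem prefixSum_one : prefixSum N 1 = 0 := prefixSum_word N []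

@[simp] theorem suffixSum_one : suffixSum N 1 = 0 := suffixSum_word N []

/-- Right recursion for the prefix sum: the only new decomposition is the one with `c'' = 1`. -/
theorem prefixSum_mul_letter (u : Words K M) (f : MonoidAlgebra K M) :
    prefixSum N (u * letter f) = prefixSum N u * letter f + letter (N (u * letter f)) := by
  induction f using single_induction with
  | zero => simp
  | add x y hx hy => simp only [map_add, mul_add, hx, hy]; abel
  | smul r x hx => simp only [map_smul, mul_smul_comm, hx, smul_add]
  | single m =>
    induction u using word_induction with
    | zero => simp
    | add x y hx hy => simp only [map_add, add_mul, hx, hy]; abel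
    | smul r x hx => simp only [map_smul, smul_mul_assoc, hx, smul_add]
    | word l =>
      rw [← word_concat, prefixSum_word, prefixSum_word, List.length_append, List.length_singleton,
        Finset.sum_range_succ, Finset.sum_mul]
      congr 1
      · refine Finset.sum_congr rfl fun j hj => ?_
        have hj := Finset.mem_range.1 hj
        rw [List.take_append_of_le_length (by omega), List.drop_append_of_le_length (by omega),
          word_concat, mul_assoc]
      · rw [List.take_of_length_le (by simp), List.drop_of_length_le (by simp), word_nil, mul_one]

/-- Left recursion for the suffix sum: the only new decomposition is the one with `a' = 1`. -/
theorem suffixSum_letter_mul (f : MonoidAlgebra K M) (u : Words K M) :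
    suffixSum N (letter f * u) = letter f * suffixSum N u + letter (N (letter f * u)) := by
  induction f using single_induction with
  | zero => simp
  | add x y hx hy => simp only [map_add, add_mul, hx, hy]; abel
  | smul r x hx => simp only [map_smul, smul_mul_assoc, hx, smul_add]
  | single m =>
    induction u using word_induction with
    | zero => simp
    | add x y hx hy => simp only [map_add, mul_add, hx, hy]; abel
    | smul r x hx => simp only [map_smul, mul_smul_comm, hx, smul_add]
    | word l =>
      rw [← word_cons, suffixSum_word, suffixSum_word, List.length_cons, Finset.sum_range_succ',
        Finset.mul_sum]
      simp only [List.take_succ_cons, List.drop_succ_cons, List.take_zero, List.drop_zero, word_nil,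
        one_mul, word_cons, mul_assoc]

theorem prefixSum_mem_positive (u : Words K M) : prefixSum N u ∈ positive K M := by
  induction u using word_induction with
  | zero => simp
  | add x x' hx hx' => rw [map_add]; exact add_mem hx hx'
  | smul r x hx => rw [map_smul]; exact Submodule.smul_mem _ _ hx
  | word l =>
    rw [prefixSum_word]
    exact Submodule.sum_mem _ fun j _ => mul_mem_positive_left (letter_mem_positive _) _

theorem suffixSum_mem_positive (u : Words K M) : suffixSum N u ∈ positive K M := by
  induction u using word_induction with
  | zero => simp
  | add x x' hx hx' => rw [map_add]; exact add_mem hx hx'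
  | smul r x hx => rw [map_smul]; exact Submodule.smul_mem _ _ hx
  | word l =>
    rw [suffixSum_word]
    exact Submodule.sum_mem _ fun j _ => mul_mem_positive_right _ (letter_mem_positive _)

/-- The linear map `a ↦ (∑ a' N(a'' c₁)) c₂ ⋯ c_q`, for a word `c = c₁ ⋯ c_q`; the sum is over the
decompositions `a = a' a''`, and the value is `0` for the empty word `c`. -/
noncomputable def headSum : List M → Words K M →ₗ[K] Words K M
  | [] => 0
  | m :: c => LinearMap.mulRight K (word K c) ∘ₗ suffixSum N ∘ₗ
      LinearMap.mulRight K (letter (MonoidAlgebra.single m 1))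

/-- The insertion product `a * c` of words: for nonempty `c = c₁ ⋯ c_q` it is
`(∑_{a = a'a''} a' N(a'' c₁)) c₂ ⋯ c_q - ∑_{c = c'c'', c' ≠ 1} a N(c') c''`.
The two terms `a c` coming from `a'' = 1` and from `c' = c₁` cancel when `N` is the identity on
letters. -/
noncomputable def ins : Words K M →ₗ[K] Words K M →ₗ[K] Words K M :=
  (extend fun c : FreeMonoid M => headSum N c.toList).flip -
    (LinearMap.mul K (Words K M)).compl₂ (prefixSum N)

theorem ins_letter_mul (a : Words K M) (f : MonoidAlgebra K M) (c : Words K M) :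
    ins N a (letter f * c) =
      suffixSum N (a * letter f) * c - a * prefixSum N (letter f * c) := by
  suffices h : (extend fun c : FreeMonoid M => headSum N c.toList) (letter f * c) a =
      suffixSum N (a * letter f) * c by
    simp [ins, h]
  induction f using single_induction with
  | zero => simp
  | add x y hx hy => simp only [map_add, add_mul, mul_add, LinearMap.add_apply, hx, hy]
  | smul r x hx =>
    simp only [map_smul, smul_mul_assoc, mul_smul_comm, LinearMap.smul_apply, hx]
  | single m =>
    induction c using word_induction with
    | zero => simp
    | add x y hx hy => simp only [map_add, mul_add, LinearMap.add_apply, hx, hy]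
    | smul r x hx => simp only [map_smul, mul_smul_comm, LinearMap.smul_apply, hx]
    | word l => rw [← word_cons, word, extend_single]; rfl

theorem ins_mem_positive (a : Words K M) {c : Words K M} (hc : c ∈ positive K M) :
    ins N a c ∈ positive K M := by
  induction hc using positive_induction with
  | zero => simp
  | add x x' _ _ hx hx' => rw [map_add]; exact add_mem hx hx'
  | smul r x _ hx => rw [map_smul]; exact Submodule.smul_mem _ _ hx
  | word m l =>
    rw [word_cons, ins_letter_mul]
    exact sub_mem (mul_mem_positive_left (suffixSum_mem_positive N _) _)
      (mul_mem_positive_right _ (prefixSum_mem_positive N _))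

/-- Right recursion for the insertion product. -/
theorem ins_mul_letter (a : Words K M) {c : Words K M} (hc : c ∈ positive K M)
    (f : MonoidAlgebra K M) :
    ins N a (c * letter f) = ins N a c * letter f - a * letter (N (c * letter f)) := by
  induction hc using positive_induction with
  | zero => simp
  | add x y _ _ hx hy => simp only [map_add, mul_add, add_mul, hx, hy]; abel
  | smul r x _ hx => simp only [map_smul, smul_mul_assoc, mul_smul_comm, hx, smul_sub]
  | word m l =>
    rw [word_cons, mul_assoc, ins_letter_mul, ins_letter_mul, ← mul_assoc (letter _) (word K l),
      prefixSum_mul_letter]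
    noncomm_ring

/-- Left recursion for the insertion product. -/
theorem letter_mul_ins (b : MonoidAlgebra K M) (a : Words K M) (f : MonoidAlgebra K M)
    (c : Words K M) :
    ins N (letter b * a) (letter f * c) =
      letter b * ins N a (letter f * c) + letter (N (letter b * a * letter f)) * c := by
  rw [ins_letter_mul, ins_letter_mul, mul_assoc (letter b), suffixSum_letter_mul]
  noncomm_ring

theorem letter_mul_ins_letter (b : MonoidAlgebra K M) (a : Words K M) (f : MonoidAlgebra K M) :
    ins N (letter b * a) (letter f) =
      letter b * ins N a (letter f) + letter (N (letter b * a * letter f)) := by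
  simpa using letter_mul_ins N b a f 1

variable {N}

theorem suffixSum_letter (hN : ∀ f, N (letter f) = f) (f : MonoidAlgebra K M) :
    suffixSum N (letter f) = letter f := by
  simpa [hN] using suffixSum_letter_mul N f 1

theorem prefixSum_letter (hN : ∀ f, N (letter f) = f) (f : MonoidAlgebra K M) :
    prefixSum N (letter f) = letter f := by
  simpa [hN] using prefixSum_mul_letter N 1 f

/-- The empty word is not a unit for the insertion product; it acts by `c ↦ c - ∑ N(c') c''`. Hence
associativity with the empty word as first factor is a property of the prefix sum. -/
theorem one_ins (hN : ∀ f, N (letter f) = f) {c : Words K M} (hc : c ∈ positive K M) :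
    ins N 1 c = c - prefixSum N c := by
  induction hc using positive_induction with
  | zero => simp
  | add x y _ _ hx hy => simp only [map_add, hx, hy]; abel
  | smul r x _ hx => simp only [map_smul, hx, smul_sub]
  | word m l => rw [word_cons, ins_letter_mul, one_mul, one_mul, suffixSum_letter hN]

theorem one_ins_letter (hN : ∀ f, N (letter f) = f) (f : MonoidAlgebra K M) :
    ins N 1 (letter f) = 0 := by
  rw [one_ins hN (letter_mem_positive f), prefixSum_letter hN, sub_self]

variable (N) in
/-- The sum of `N(a c') c''` over the decompositions `c = c' c''` with `c'` nonempty. -/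
noncomputable def prefixSumAfter (a : Words K M) : Words K M →ₗ[K] Words K M :=
  prefixSum N ∘ₗ LinearMap.mulLeft K a - LinearMap.mulLeft K (prefixSum N a)

theorem prefixSumAfter_apply (a c : Words K M) :
    prefixSumAfter N a c = prefixSum N (a * c) - prefixSum N a * c := rfl

theorem prefixSumAfter_one_right (a : Words K M) : prefixSumAfter N a 1 = 0 := by
  simp [prefixSumAfter_apply]

theorem prefixSumAfter_one_left (c : Words K M) : prefixSumAfter N 1 c = prefixSum N c := by
  simp [prefixSumAfter_apply]

/-- Left recursion: the first letter of `b c` joins the letters `a` placed in front. The prefix sum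
itself has no left recursion, which is why `prefixSumAfter` is needed. -/
theorem prefixSumAfter_letter_mul (a : Words K M) (b : MonoidAlgebra K M) (c : Words K M) :
    prefixSumAfter N a (letter b * c) =
      letter (N (a * letter b)) * c + prefixSumAfter N (a * letter b) c := by
  rw [prefixSumAfter_apply, prefixSumAfter_apply, prefixSum_mul_letter, mul_assoc]
  noncomm_ring

theorem prefixSumAfter_letter (a : Words K M) (b : MonoidAlgebra K M) :
    prefixSumAfter N a (letter b) = letter (N (a * letter b)) := by
  rw [prefixSumAfter_apply, prefixSum_mul_letter]
  abel

/-- The failure of the prefix sum to commute with `(- * f)`, computed for all `a` at once so that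
induction on the first letter of `c` applies. No relation is used here: the relations make the
right side vanish for `a = 1`, see `map_ins_letter`. -/
theorem prefixSumAfter_ins_letter (hN : ∀ f, N (letter f) = f) (f : MonoidAlgebra K M)
    (c : List M) (a : Words K M) :
    prefixSumAfter N a (ins N (word K c) (letter f)) -
        ins N (prefixSumAfter N a (word K c)) (letter f) =
      letter (N (a * ins N (word K c) (letter f))) -
        letter (N (prefixSumAfter N a (word K c) * letter f)) := by
  induction c generalizing a with
  | nil => simp [word_nil, one_ins_letter hN, prefixSumAfter_one_right]
  | cons b c ih =>
    have ih := ih (a * letter (MonoidAlgebra.single b 1))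
    simp only [word_cons, letter_mul_ins_letter, map_add, prefixSumAfter_letter_mul,
      prefixSumAfter_letter, LinearMap.add_apply, mul_add, add_mul, ← mul_assoc] at ih ⊢
    rw [sub_eq_iff_eq_add] at ih
    rw [ih]
    abel

/-- The relations of an `𝒩`-algebra with last argument `f`, in the form
`N(a, N(c, f)) = N(a * c, f)`. -/
def RelAt (N : Words K M →ₗ[K] MonoidAlgebra K M) (f : MonoidAlgebra K M) : Prop :=
  ∀ a ∈ positive K M, ∀ c ∈ positive K M,
    N (a * letter (N (c * letter f))) = N (ins N a c * letter f)

variable (N) in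
/-- The sum of `a' N(a'' c') c''` over the decompositions `a = a' a''` and `c = c' c''` with `a''`
and `c'` nonempty. -/
noncomputable def middleSum : List M → Words K M → Words K M
  | [], _ => 0
  | e :: a, c => letter (MonoidAlgebra.single e 1) * middleSum a c +
      prefixSumAfter N (word K (e :: a)) c

theorem middleSum_one (a : List M) : middleSum N a 1 = 0 := by
  induction a with
  | nil => rfl
  | cons e a ih => rw [middleSum, ih, prefixSumAfter_one_right]; simp

/-- The first letter of `b c` moves to the end of `a`; the decompositions gained and lost are those
counted by the insertion product `a * (b c)`. -/
theorem middleSum_letter_mul (hN : ∀ f, N (letter f) = f) (a : List M) (b : M) (c : Words K M)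
    (hc : letter (MonoidAlgebra.single b 1) * c ∈ positive K M) :
    middleSum N a (letter (MonoidAlgebra.single b 1) * c) =
      ins N (word K a) (letter (MonoidAlgebra.single b 1) * c) + middleSum N (a ++ [b]) c := by
  induction a with
  | nil =>
    rw [word_nil, one_ins hN hc]
    simp [middleSum, prefixSumAfter_apply, word_nil, word_cons,
      prefixSum_letter hN]
  | cons e a ih =>
    rw [List.cons_append, middleSum, middleSum, ih, ← List.cons_append, word_concat, word_cons,
      letter_mul_ins, prefixSumAfter_letter_mul]
    noncomm_ring

/-- Expanding `c * f = ∑ c' N(c'' f)` and applying the relations to each `N(a c', N(c'', f))` gives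
`∑ N((a c') * c'', f)`, and the products `(a c') * c''` telescope to the middle sum. -/
theorem map_mul_ins_letter (hN : ∀ f, N (letter f) = f) {f : MonoidAlgebra K M} (hf : RelAt N f)
    (c : List M) (a : List M) (ha : a ≠ []) :
    N (word K a * ins N (word K c) (letter f)) = N (middleSum N a (word K c) * letter f) := by
  induction c generalizing a with
  | nil => simp [word_nil, one_ins_letter hN, middleSum_one]
  | cons b c ih =>
    have hc : word K (b :: c) ∈ positive K M := word_mem_positive (by simp)
    rw [word_cons] at hc ⊢
    rw [middleSum_letter_mul hN a b _ hc, letter_mul_ins_letter, mul_add, map_add, ← mul_assoc,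
      ← word_concat, ih _ (by simp), hf _ (word_mem_positive ha) _ hc, add_mul, map_add, add_comm]

/-- The case of a word `a` of one letter `b` in `map_mul_ins_letter`; the middle sum of `b` and `c`
is the prefix sum of `b c` without its first term `b c`. -/
theorem map_ins_letter (hN : ∀ f, N (letter f) = f) {f : MonoidAlgebra K M} (hf : RelAt N f)
    {c : Words K M} (hc : c ∈ positive K M) :
    N (ins N c (letter f)) = N (prefixSum N c * letter f) := by
  induction hc using positive_induction with
  | zero => simp
  | add x y _ _ hx hy => simp only [map_add, add_mul, LinearMap.add_apply, hx, hy]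
  | smul r x _ hx => simp only [map_smul, smul_mul_assoc, LinearMap.smul_apply, hx]
  | word b c =>
    have h := map_mul_ins_letter hN hf c [b] (by simp)
    rw [word_cons, letter_mul_ins_letter, map_add, hN]
    rw [← letter_single] at h
    rw [h, ← map_add, ← add_mul]
    simp [middleSum, prefixSumAfter_apply, word_cons, word_nil, prefixSum_letter hN]

/-- The prefix sum commutes with right insertion of a letter. Together with `one_ins` this is
associativity for the empty word as first factor. -/
theorem prefixSum_ins_letter (hN : ∀ f, N (letter f) = f) {f : MonoidAlgebra K M}
    (hf : RelAt N f) {c : Words K M} (hc : c ∈ positive K M) :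
    prefixSum N (ins N c (letter f)) = ins N (prefixSum N c) (letter f) := by
  induction hc using positive_induction with
  | zero => simp
  | add x y _ _ hx hy => simp only [map_add, LinearMap.add_apply, hx, hy]
  | smul r x _ hx => simp only [map_smul, LinearMap.smul_apply, hx]
  | word b c =>
    have h := prefixSumAfter_ins_letter hN f (b :: c) 1
    rw [prefixSumAfter_one_left, prefixSumAfter_one_left, one_mul,
      map_ins_letter hN hf (word_mem_positive (by simp)), sub_self] at h
    exact sub_eq_zero.1 h

/-- Associativity for a last factor of one letter, by recursion on the first letter of `a`; the
relations with last argument `f` make the extra terms of the recursion agree. -/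
theorem ins_assoc_letter (hN : ∀ f, N (letter f) = f) {f : MonoidAlgebra K M} (hf : RelAt N f)
    (a : List M) (e : M) (c : List M) :
    ins N (ins N (word K a) (word K (e :: c))) (letter f) =
      ins N (word K a) (ins N (word K (e :: c)) (letter f)) := by
  have hc : word K (e :: c) ∈ positive K M := word_mem_positive (by simp)
  induction a with
  | nil =>
    rw [word_nil, one_ins hN hc, one_ins hN (ins_mem_positive N _ (letter_mem_positive f)),
      map_sub, LinearMap.sub_apply, prefixSum_ins_letter hN hf hc]
  | cons b a ih =>
    have h := hf (word K (b :: a)) (word_mem_positive (by simp)) _ hc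
    rw [word_cons b a, word_cons e c] at *
    rw [letter_mul_ins] at h ⊢
    rw [letter_mul_ins_letter, map_add] at ih ⊢
    rw [map_add, letter_mul_ins, letter_mul_ins_letter, h, LinearMap.add_apply,
      letter_mul_ins_letter, letter_mul_ins_letter, ih, add_mul]
    simp only [map_add, mul_add]
    abel

/-- The insertion product is associative if the letters of the last factor satisfy the relations:
passing from `d` to `d m`, the difference of the two sides changes by the relation with last
argument `m`. -/
theorem ins_assoc (hN : ∀ f, N (letter f) = f) (a : Words K M) {c : Words K M}
    (hc : c ∈ positive K M) (d : List M) (hd : d ≠ [])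
    (h : ∀ m ∈ d, RelAt N (MonoidAlgebra.single m 1)) :
    ins N (ins N a c) (word K d) = ins N a (ins N c (word K d)) := by
  induction d using List.reverseRecOn with
  | nil => exact absurd rfl hd
  | append_singleton d m ih =>
    have hm := h m (by simp)
    rcases eq_or_ne d [] with rfl | hd'
    · clear ih
      rw [List.nil_append, ← letter_single]
      induction hc using positive_induction with
      | zero => simp
      | add x y _ _ hx hy => simp only [map_add, LinearMap.add_apply, hx, hy]
      | smul r x _ hx => simp only [map_smul, LinearMap.smul_apply, hx]
      | word b c =>
        induction a using word_induction with
        | zero => simp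
        | add x y hx hy => simp only [map_add, LinearMap.add_apply, hx, hy]
        | smul r x hx => simp only [map_smul, LinearMap.smul_apply, hx]
        | word a => exact ins_assoc_letter hN hm a b c
    · have ih := ih hd' fun m hm => h m (by simp [hm])
      have hd := word_mem_positive (K := K) hd'
      rw [word_concat, ins_mul_letter N _ hd, ins_mul_letter N _ hd, map_sub,
        ins_mul_letter N _ (ins_mem_positive N _ hd), ins_mul_letter N _ hc,
        hm _ hc _ hd, ih]
      abel

end insertion

/-! ### A uniform shape for the relations -/

section uniform

variable {A : Type v}

/-- The operations of all arities, extended by the identity in arity one. -/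
def fullOp [Zero A] (N : ∀ n : ℕ, (Fin (n + 2) → A) → A) : List A → A
  | [a] => a
  | l => applyOp N l

theorem fullOp_eq_applyOp [Zero A] (N : ∀ n : ℕ, (Fin (n + 2) → A) → A) {l : List A}
    (hl : 2 ≤ l.length) : fullOp N l = applyOp N l := by
  match l, hl with
  | _ :: _ :: _, _ => rfl

/-- The three families of relations of an `𝒩`-algebra, written as one family:
`N(as, N(c, cs, w)) = ∑ N(as', N(as'', c), cs, w) - ∑ N(as, N(c, cs'), cs'', w)`, the sums being
over the decompositions `as = as' as''` and `cs = cs' cs''` with `as''` and `cs'` nonempty. -/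
def UniformRel [AddCommGroup A] (op : List A → A) : Prop :=
  ∀ (as : List A) (c : A) (cs : List A) (w : A), as ≠ [] →
    op (as ++ [op (c :: (cs ++ [w]))]) =
      ∑ i ∈ Finset.range as.length, op (as.take i ++ op (as.drop i ++ [c]) :: (cs ++ [w])) -
        ∑ j ∈ Finset.range cs.length,
          op (as ++ op (c :: cs.take (j + 1)) :: (cs.drop (j + 1) ++ [w]))

/-- The operations of an `𝒩`-algebra as functions. -/
abbrev ops (K : Type u) (A : Type v) [Field K] [AddCommGroup A] [Module K A] [NAlgebra K A]
    (n : ℕ) : (Fin (n + 2) → A) → A := NAlgebra.N (K := K) n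

theorem uniformRel_ops (K : Type u) [Field K] [AddCommGroup A] [Module K A] [NAlgebra K A] :
    UniformRel (fullOp (ops K A)) := by
  intro as c cs w has
  obtain ⟨a, as, rfl⟩ := List.exists_cons_of_ne_nil has
  rw [fullOp_eq_applyOp _ (l := _ ++ _) (by simp),
    fullOp_eq_applyOp _ (l := c :: (_ ++ _)) (by simp)]
  have h₁ : ∀ i ∈ Finset.range (a :: as).length,
      fullOp (ops K A) ((a :: as).take i ++ fullOp (ops K A) ((a :: as).drop i ++ [c]) ::
        (cs ++ [w])) =
      applyOp (ops K A) ((a :: as).take i ++ applyOp (ops K A) ((a :: as).drop i ++ [c]) ::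
        (cs ++ [w])) := by
    intro i hi
    have hi := Finset.mem_range.1 hi
    rw [fullOp_eq_applyOp _ (by simp; omega), fullOp_eq_applyOp _ (by
      rw [List.length_append, List.length_drop, List.length_singleton]; omega)]
  have h₂ : ∀ j ∈ Finset.range cs.length,
      fullOp (ops K A) (a :: as ++ fullOp (ops K A) (c :: cs.take (j + 1)) ::
        (cs.drop (j + 1) ++ [w])) =
      applyOp (ops K A) (a :: as ++ applyOp (ops K A) (c :: cs.take (j + 1)) ::
        (cs.drop (j + 1) ++ [w])) := by
    intro i hi
    have hi := Finset.mem_range.1 hi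
    rw [fullOp_eq_applyOp _ (by simp; omega), fullOp_eq_applyOp _ (by simp; omega)]
  rw [Finset.sum_congr rfl h₁, Finset.sum_congr rfl h₂]
  rcases eq_or_ne cs [] with rfl | hcs
  · simpa using NAlgebra.rel_one (K := K) (a :: as) c w (by simp)
  · rcases eq_or_ne as [] with rfl | has'
    · simpa using NAlgebra.rel_two (K := K) a c cs w hcs
    · rw [List.length_cons, Finset.sum_range_succ']
      have h := NAlgebra.rel_three (K := K) a as c cs w has' hcs
      simp only [List.cons_append, List.append_assoc, List.nil_append, List.take_succ_cons,
        List.drop_succ_cons, List.take_zero, List.drop_zero] at h ⊢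
      rw [h]
      abel

/-- Multilinear operations satisfying the uniform relations make an `𝒩`-algebra. -/
@[reducible]
def ofUniformRel (K : Type u) [Field K] [AddCommGroup A] [Module K A]
    (N : ∀ n : ℕ, MultilinearMap K (fun _ : Fin (n + 2) => A) A)
    (h : UniformRel (fullOp fun n => N n)) : NAlgebra K A where
  N := N
  rel_one xs y z hxs := by
    have h := h xs y [] z hxs
    rw [fullOp_eq_applyOp _ (l := _ ++ _) (by
      have := List.length_pos_iff.2 hxs; simp; omega), fullOp_eq_applyOp _ (by simp)] at h
    refine h.trans ?_
    rw [List.length_nil, Finset.sum_range_zero, sub_zero]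
    refine Finset.sum_congr rfl fun i hi => ?_
    have hi := Finset.mem_range.1 hi
    rw [fullOp_eq_applyOp _ (by simp), fullOp_eq_applyOp _ (by simp; omega)]
    rfl
  rel_two a b ts w hts := by
    have h := h [a] b ts w (by simp)
    rw [fullOp_eq_applyOp _ (l := _ ++ _) (by simp), fullOp_eq_applyOp _ (by simp),
      List.length_singleton, Finset.sum_range_one, fullOp_eq_applyOp _ (by simp),
      fullOp_eq_applyOp _ (by simp)] at h
    refine h.trans (congrArg₂ _ rfl (Finset.sum_congr rfl fun j hj => ?_))
    have hj := Finset.mem_range.1 hj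
    rw [fullOp_eq_applyOp _ (by simp), fullOp_eq_applyOp _ (by simp; omega)]
    rfl
  rel_three x ys z ts w hys hts := by
    have h := h (x :: ys) z ts w (by simp)
    rw [fullOp_eq_applyOp _ (l := _ ++ _) (by simp), fullOp_eq_applyOp _ (by simp),
      List.length_cons, Finset.sum_range_succ', add_comm (∑ _ ∈ _, _),
      fullOp_eq_applyOp _ (by simp), fullOp_eq_applyOp _ (by simp)] at h
    refine h.trans (congrArg₂ _ (congrArg₂ _ rfl (Finset.sum_congr rfl fun i hi => ?_))
      (Finset.sum_congr rfl fun j hj => ?_))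
    · have hi := Finset.mem_range.1 hi
      rw [fullOp_eq_applyOp _ (by simp; omega), fullOp_eq_applyOp _ (by simp; omega)]
      simp
    · have hj := Finset.mem_range.1 hj
      rw [fullOp_eq_applyOp _ (by simp; omega), fullOp_eq_applyOp _ (by simp; omega)]
      simp

end uniform

/-! ### The model on planar binary trees -/

section model

variable {K : Type u} [Field K]

/-- The product, in the tensor algebra, of a list of elements of the space of letters. -/
noncomputable def letters {M : Type v} (l : List (MonoidAlgebra K M)) : Words K M :=
  (l.map letter).prod

theorem letters_cons {M : Type v} (f : MonoidAlgebra K M) (l : List (MonoidAlgebra K M)) :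
    letters (f :: l) = letter f * letters l := by simp [letters]

theorem letters_append {M : Type v} (l l' : List (MonoidAlgebra K M)) :
    letters (l ++ l') = letters l * letters l' := by simp [letters]

theorem letters_singleton {M : Type v} (f : MonoidAlgebra K M) : letters [f] = letter f := by
  simp [letters]

theorem letters_nil {M : Type v} : letters ([] : List (MonoidAlgebra K M)) = 1 := rfl

theorem letters_map_single {M : Type v} (l : List M) :
    letters (l.map fun m => MonoidAlgebra.single m (1 : K)) = word K l := by
  induction l with
  | nil => rfl
  | cons m l ih => rw [List.map_cons, letters_cons, ih, word_cons]

theorem letters_mem_positive {M : Type v} {l : List (MonoidAlgebra K M)} (hl : l ≠ []) :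
    letters l ∈ positive K M := by
  obtain ⟨f, l, rfl⟩ := List.exists_cons_of_ne_nil hl
  rw [letters_cons]
  exact mul_mem_positive_left (letter_mem_positive f) _

section

variable {M : Type v} (N : Words K M →ₗ[K] MonoidAlgebra K M)

theorem suffixSum_letters (l : List (MonoidAlgebra K M)) : suffixSum N (letters l) =
    ∑ j ∈ Finset.range l.length, letters (l.take j) * letter (N (letters (l.drop j))) := by
  induction l with
  | nil => simp [letters_nil]
  | cons f l ih =>
    rw [letters_cons, suffixSum_letter_mul, ih, List.length_cons, Finset.sum_range_succ',
      Finset.mul_sum]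
    simp [letters_cons, letters_nil, mul_assoc]

theorem prefixSum_letters (l : List (MonoidAlgebra K M)) : prefixSum N (letters l) =
    ∑ j ∈ Finset.range l.length,
      letter (N (letters (l.take (j + 1)))) * letters (l.drop (j + 1)) := by
  induction l using List.reverseRecOn with
  | nil => simp [letters_nil]
  | append_singleton l f ih =>
    rw [letters_append, letters_singleton, prefixSum_mul_letter, ih, List.length_append,
      List.length_singleton, Finset.sum_range_succ, Finset.sum_mul]
    congr 1
    · refine Finset.sum_congr rfl fun j hj => ?_
      have hj := Finset.mem_range.1 hj
      rw [List.take_append_of_le_length (by omega), List.drop_append_of_le_length (by omega),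
        letters_append, letters_singleton, mul_assoc]
    · rw [List.take_of_length_le (by simp), List.drop_of_length_le (by simp), letters_nil, mul_one,
        letters_append, letters_singleton]

theorem ins_letters (hN : ∀ f, N (letter f) = f) (as : List (MonoidAlgebra K M))
    (c : MonoidAlgebra K M) (cs : List (MonoidAlgebra K M)) :
    ins N (letters as) (letters (c :: cs)) =
      ∑ i ∈ Finset.range as.length,
          letters (as.take i) * letter (N (letters (as.drop i ++ [c]))) * letters cs -
        ∑ j ∈ Finset.range cs.length, letters as *
          (letter (N (letters (c :: cs.take (j + 1)))) * letters (cs.drop (j + 1))) := by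
  rw [letters_cons, ins_letter_mul, ← letters_cons, ← letters_singleton c, ← letters_append,
    suffixSum_letters, prefixSum_letters, List.length_append, List.length_singleton,
    Finset.sum_range_succ, List.length_cons, Finset.sum_range_succ', add_mul, mul_add,
    Finset.sum_mul, Finset.mul_sum]
  -- the two terms `as c cs` cancel
  have h₁ : letters ((as ++ [c]).take as.length) *
      letter (N (letters ((as ++ [c]).drop as.length))) * letters cs = letters as *
      (letter (N (letters ((c :: cs).take (0 + 1)))) * letters ((c :: cs).drop (0 + 1))) := by
    simp [letters_singleton, hN, mul_assoc]
  have h₂ : ∀ i ∈ Finset.range as.length, letters ((as ++ [c]).take i) *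
      letter (N (letters ((as ++ [c]).drop i))) * letters cs =
      letters (as.take i) * letter (N (letters (as.drop i ++ [c]))) * letters cs := by
    intro i hi
    have hi := Finset.mem_range.1 hi
    rw [List.take_append_of_le_length (by omega), List.drop_append_of_le_length (by omega)]
  rw [h₁, Finset.sum_congr rfl h₂, add_sub_add_right_eq_sub]
  rfl

/-- The multilinear operations defined by a linear map on the tensor algebra. -/
noncomputable def multiOp (n : ℕ) :
    MultilinearMap K (fun _ : Fin (n + 2) => MonoidAlgebra K M) (MonoidAlgebra K M) :=
  N.compMultilinearMap
    ((MultilinearMap.mkPiAlgebraFin K (n + 2) (Words K M)).compLinearMap fun _ => letter)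

theorem multiOp_apply (n : ℕ) (v : Fin (n + 2) → MonoidAlgebra K M) :
    multiOp N n v = N (letters (List.ofFn v)) := by
  simp [multiOp, letters, List.map_ofFn]
  rfl

theorem fullOp_multiOp (hN : ∀ f, N (letter f) = f) (l : List (MonoidAlgebra K M)) (hl : l ≠ []) :
    fullOp (fun n => multiOp N n) l = N (letters l) := by
  match l, hl with
  | [f], _ => rw [letters_singleton, hN]; rfl
  | f :: g :: l, _ =>
    refine (multiOp_apply N l.length _).trans ?_
    congr 2
    exact List.ofFn_get (f :: g :: l)

theorem uniformRel_multiOp (hN : ∀ f, N (letter f) = f) (h : ∀ f, RelAt N f) :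
    UniformRel (fullOp fun n => multiOp N n) := by
  intro as c cs w has
  have key : N (letters as * letter (N (letters (c :: cs) * letter w))) =
      N (ins N (letters as) (letters (c :: cs)) * letter w) :=
    h w _ (letters_mem_positive has) _ (letters_mem_positive (by simp))
  rw [ins_letters N hN, sub_mul, Finset.sum_mul, Finset.sum_mul, map_sub, map_sum, map_sum] at key
  rw [fullOp_multiOp N hN (_ ++ _) (by simp), fullOp_multiOp N hN (_ :: _) (by simp)]
  simp only [letters_append, letters_cons, letters_nil, mul_one] at key ⊢
  rw [← mul_assoc, key]
  congr 1
  · refine Finset.sum_congr rfl fun i _ => ?_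
    rw [fullOp_multiOp N hN _ (by simp), fullOp_multiOp N hN _ (by simp)]
    simp only [letters_append, letters_cons, letters_nil, mul_one, mul_assoc]
  · refine Finset.sum_congr rfl fun i _ => ?_
    rw [fullOp_multiOp N hN _ (by simp), fullOp_multiOp N hN _ (by simp)]
    simp only [letters_append, letters_cons, letters_nil, mul_one, mul_assoc]

end

end model

section trees

variable {K : Type u} [Field K] {X : Type v}

/-- The tree `d₁ (d₂ (⋯ (d_p x)))`. A planar binary tree is written in this way in exactly one way;
it stands for the monomial `N(d₁, …, d_p, x)`, whose last argument is a variable. -/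
def rightComb (d : List (FreeMagma X)) (x : X) : FreeMagma X := d.foldr (· * ·) (.of x)

/-- The left factors `d₁, …, d_p` of the tree `d₁ (d₂ (⋯ (d_p x)))`. -/
def spine : FreeMagma X → List (FreeMagma X)
  | .of _ => []
  | .mul c b => c :: spine b

/-- The rightmost leaf of a tree. -/
def lastLeaf : FreeMagma X → X
  | .of x => x
  | .mul _ b => lastLeaf b

theorem rightComb_spine (b : FreeMagma X) : rightComb (spine b) (lastLeaf b) = b := by
  induction b with
  | ih1 x => rfl
  | ih2 c b _ ih => exact congrArg (c * ·) ih

/-- Induction on the spine: a property holds for all trees if it holds for each tree whose left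
factors have it. -/
theorem spine_induction {P : FreeMagma X → Prop}
    (h : ∀ d x, (∀ e ∈ d, P e) → P (rightComb d x)) (b : FreeMagma X) : P b := by
  suffices H : ∀ b : FreeMagma X, ∀ e ∈ spine b, P e by
    rw [← rightComb_spine b]
    exact h _ _ (H b)
  intro b
  induction b with
  | ih1 x => simp [spine]
  | ih2 c b hc hb =>
    intro e he
    rcases List.mem_cons.1 he with rfl | he
    · rw [← rightComb_spine e]
      exact h _ _ hc
    · exact hb e he

variable (K) in
/-- The tensor algebra acts on the space of trees: a letter acts by left multiplication. -/
noncomputable def act : Words K (FreeMagma X) →ₐ[K]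
    Module.End K (MonoidAlgebra K (FreeMagma X)) :=
  MonoidAlgebra.lift K _ _ (FreeMonoid.lift fun m =>
    LinearMap.mulLeft K (MonoidAlgebra.single m (1 : K)))

theorem act_letter (f g : MonoidAlgebra K (FreeMagma X)) : act K (letter f) g = f * g := by
  induction f using single_induction with
  | zero => simp
  | add x y hx hy => simp only [map_add, add_mul, LinearMap.add_apply, hx, hy]
  | smul r x hx => simp only [map_smul, smul_mul_assoc, LinearMap.smul_apply, hx]
  | single m =>
    rw [letter_single, word, act, MonoidAlgebra.lift_single, one_smul]
    rfl

theorem act_word (d : List (FreeMagma X)) (x : X) :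
    act K (word K d) (MonoidAlgebra.single (.of x) 1) =
      MonoidAlgebra.single (rightComb d x) 1 := by
  induction d with
  | nil => rw [word_nil, map_one]; rfl
  | cons m d ih =>
    rw [word_cons, map_mul, Module.End.mul_apply, ih, act_letter, MonoidAlgebra.single_mul_single,
      one_mul]
    rfl

variable (K) in
/-- Auxiliary recursion for the operations. The first component sends a nonempty list `a` of trees
to `N(a, b)`, and the empty list to the correction term needed to continue the recursion; for
`b = d₁ (⋯ (d_p x))`, the second component sends a nonempty list `u` to the sum of
`N(u, d₁, …, d_j) (d_{j+1} (⋯ (d_p x)))` over `1 ≤ j ≤ p`. -/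
noncomputable def opAux : FreeMagma X →
    (List (FreeMagma X) → MonoidAlgebra K (FreeMagma X)) ×
      (List (FreeMagma X) → MonoidAlgebra K (FreeMagma X))
  | .of x => (fun a => MonoidAlgebra.single (rightComb a x) 1, fun _ => 0)
  | .mul c b =>
    (fun a => List.rec (-(opAux b).2 [c])
      (fun e as r => (opAux c).1 (e :: as) * MonoidAlgebra.single b 1 +
        MonoidAlgebra.single e 1 * r) a,
    fun u => (opAux c).1 u * MonoidAlgebra.single b 1 + (opAux b).2 (u ++ [c]))

variable (K) in
/-- The value of the operations on a list of trees; it is the identity in arity one. -/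
noncomputable def treeOp : List (FreeMagma X) → MonoidAlgebra K (FreeMagma X)
  -- junk value: there is no operation of arity zero
  | [] => 0
  | [b] => MonoidAlgebra.single b 1
  | a :: b :: l => (opAux K ((a :: b :: l).getLast (by simp))).1 ((a :: b :: l).dropLast)

variable (K X) in
/-- The operations on the space of trees, all arities together. -/
noncomputable def modelOp :
    Words K (FreeMagma X) →ₗ[K] MonoidAlgebra K (FreeMagma X) :=
  extend fun l : FreeMonoid (FreeMagma X) => treeOp K l.toList

theorem modelOp_word (l : List (FreeMagma X)) : modelOp K X (word K l) = treeOp K l :=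
  extend_single _ _

theorem modelOp_letter (f : MonoidAlgebra K (FreeMagma X)) : modelOp K X (letter f) = f := by
  induction f using single_induction with
  | zero => simp
  | add x y hx hy => simp only [map_add, hx, hy]
  | smul r x hx => simp only [map_smul, hx]
  | single m => rw [letter_single, modelOp_word]; rfl

theorem modelOp_concat (a : List (FreeMagma X)) (ha : a ≠ []) (b : FreeMagma X) :
    modelOp K X (word K (a ++ [b])) = (opAux K b).1 a := by
  rw [modelOp_word]
  match a, ha with
  | [e], _ => rfl
  | e :: e' :: a, _ =>
    change (opAux K ((e :: e' :: (a ++ [b])).getLast _)).1 ((e :: e' :: (a ++ [b])).dropLast) = _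
    have h₁ : (e :: e' :: (a ++ [b])).getLast (by simp) = b := by
      simp [List.getLast_cons]
    have h₂ : (e :: e' :: (a ++ [b])).dropLast = e :: e' :: a :=
      List.dropLast_concat (l₁ := e :: e' :: a)
    rw [h₁, h₂]

/-- The second component of the recursion is a prefix sum, applied to the rightmost leaf. -/
theorem opAux_snd (d : List (FreeMagma X)) (x : X) (u : List (FreeMagma X)) (hu : u ≠ []) :
    (opAux K (rightComb d x)).2 u =
      act K (prefixSumAfter (modelOp K X) (word K u) (word K d))
        (MonoidAlgebra.single (.of x) 1) := by
  induction d generalizing u with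
  | nil => rw [word_nil, prefixSumAfter_one_right, map_zero]; rfl
  | cons c d ih =>
    rw [word_cons, prefixSumAfter_letter_mul, ← word_concat, map_add, LinearMap.add_apply,
      ← ih _ (by simp), map_mul, Module.End.mul_apply, act_word, act_letter,
      modelOp_concat _ hu]
    rfl

/-- The recursion for `N(a, d₁ (⋯ (d_p x)))` is the left recursion for the insertion product
`a * d₁ ⋯ d_p`, applied to `x`; the correction term stands for the empty word `a`. -/
theorem opAux_fst (c : FreeMagma X) (d : List (FreeMagma X)) (x : X) (a : List (FreeMagma X)) :
    (opAux K (rightComb (c :: d) x)).1 a =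
      act K (ins (modelOp K X) (word K a) (word K (c :: d)))
        (MonoidAlgebra.single (.of x) 1) := by
  induction a with
  | nil =>
    change -(opAux K (rightComb d x)).2 [c] = _
    rw [word_nil, one_ins modelOp_letter (word_mem_positive (by simp)), opAux_snd _ _ _ (by simp),
      prefixSumAfter_apply, ← word_append, ← letter_single, prefixSum_letter modelOp_letter,
      ← word_cons, ← LinearMap.neg_apply, ← map_neg, neg_sub]
    rfl
  | cons e a ih =>
    change (opAux K c).1 (e :: a) * MonoidAlgebra.single (rightComb d x) 1 +
      MonoidAlgebra.single e 1 * (opAux K (rightComb (c :: d) x)).1 a = _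
    rw [ih, word_cons e a, word_cons c d, letter_mul_ins, ← word_cons e a, ← word_concat,
      modelOp_concat _ (by simp), map_add, LinearMap.add_apply, map_mul (act K), map_mul (act K),
      Module.End.mul_apply, Module.End.mul_apply, act_letter, act_letter, act_word, add_comm]

theorem modelOp_mul_act {a d : Words K (FreeMagma X)} (ha : a ∈ positive K _)
    (hd : d ∈ positive K _) (x : X) :
    modelOp K X (a * letter (act K d (MonoidAlgebra.single (.of x) 1))) =
      act K (ins (modelOp K X) a d) (MonoidAlgebra.single (.of x) 1) := by
  induction ha using positive_induction with
  | zero => simp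
  | add a a' _ _ h h' => simp only [add_mul, map_add, LinearMap.add_apply, h, h']
  | smul r a _ h => simp only [smul_mul_assoc, map_smul, LinearMap.smul_apply, h]
  | word e a =>
    induction hd using positive_induction with
    | zero => simp
    | add a a' _ _ h h' => simp only [mul_add, map_add, LinearMap.add_apply, h, h']
    | smul r a _ h => simp only [mul_smul_comm, map_smul, LinearMap.smul_apply, h]
    | word c d => rw [act_word, ← word_concat, modelOp_concat _ (by simp), opAux_fst]

theorem modelOp_mul_leaf {a : Words K (FreeMagma X)} (ha : a ∈ positive K _) (x : X) :
    modelOp K X (a * letter (MonoidAlgebra.single (.of x) 1)) =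
      act K a (MonoidAlgebra.single (.of x) 1) := by
  induction ha using positive_induction with
  | zero => simp
  | add a a' _ _ h h' => simp only [add_mul, map_add, LinearMap.add_apply, h, h']
  | smul r a _ h => simp only [smul_mul_assoc, map_smul, LinearMap.smul_apply, h]
  | word e a => rw [act_word, ← word_concat, modelOp_concat _ (by simp)]; rfl

/-- For `b = d₁ (⋯ (d_p x))`, the two sides of the relation are `a * (c * d)` and `(a * c) * d`,
applied to `x`. -/
theorem relAt_single (b : FreeMagma X) :
    RelAt (modelOp K X) (MonoidAlgebra.single b (1 : K)) := by
  induction b using spine_induction with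
  | h d x ih =>
    intro a ha c hc
    rcases eq_or_ne d [] with rfl | hd
    · have e : rightComb [] x = FreeMagma.of x := rfl
      rw [e, modelOp_mul_leaf hc x, modelOp_mul_act ha hc x,
        modelOp_mul_leaf (ins_mem_positive _ _ hc) x]
    · have hd' := word_mem_positive (K := K) hd
      rw [← act_word d x, modelOp_mul_act hc hd' x,
        modelOp_mul_act ha (ins_mem_positive _ _ hd') x,
        modelOp_mul_act (ins_mem_positive _ _ hc) hd' x,
        ins_assoc modelOp_letter _ hc d hd ih]

theorem relAt (f : MonoidAlgebra K (FreeMagma X)) : RelAt (modelOp K X) f := by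
  intro a ha c hc
  induction f using single_induction with
  | zero => simp
  | add x y hx hy => simp only [map_add, mul_add, hx, hy]
  | smul r x hx => simp only [map_smul, mul_smul_comm, hx]
  | single b => exact relAt_single b a ha c hc

/-- The space of planar binary trees is an `𝒩`-algebra, in which `N(d₁, …, d_p, x)` is the tree
`d₁ (⋯ (d_p x))` for all trees `d_i` and every variable `x`. -/
noncomputable instance instNAlgebraTrees : NAlgebra K (MonoidAlgebra K (FreeMagma X)) :=
  ofUniformRel K (multiOp (modelOp K X)) (uniformRel_multiOp _ modelOp_letter relAt)

theorem fullOp_ops_trees (l : List (MonoidAlgebra K (FreeMagma X))) (hl : l ≠ []) :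
    fullOp (ops K (MonoidAlgebra K (FreeMagma X))) l = modelOp K X (letters l) :=
  fullOp_multiOp _ modelOp_letter l hl

end trees

/-! ### The free `𝒩`-algebra as the space of planar binary trees -/

section free

variable {K : Type u} [Field K] {X : Type v}

theorem applyOp_eq {A : Type w} [Zero A] (N : ∀ n : ℕ, (Fin (n + 2) → A) → A) (l : List A) (n : ℕ)
    (h : l.length = n + 2) : applyOp N l = N n fun i => l[i.1]'(by omega) := by
  match l, h with
  | a :: b :: l, h =>
    obtain rfl : l.length = n := by simpa using h
    rfl

theorem applyOp_ofFn {A : Type w} [Zero A] (N : ∀ n : ℕ, (Fin (n + 2) → A) → A) {n : ℕ}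
    (v : Fin (n + 2) → A) : applyOp N (List.ofFn v) = N n v := by
  rw [applyOp_eq N _ n (by simp)]
  congr 1
  funext i
  rw [List.getElem_ofFn]

/-- The operations are linear in each argument. -/
theorem exists_linear_fullOp {A : Type w} [AddCommGroup A] [Module K A] [NAlgebra K A]
    (l l' : List A) (h : l' ≠ []) :
    ∃ φ : A →ₗ[K] A, ∀ f, fullOp (ops K A) (l ++ f :: l') = φ f := by
  have hl := List.length_pos_iff.2 h
  obtain ⟨n, hn⟩ : ∃ n, l.length + (l'.length + 1) = n + 2 := ⟨l.length + l'.length - 1, by omega⟩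
  refine ⟨(NAlgebra.N (K := K) n).toLinearMap
    (fun i => (l ++ 0 :: l')[i.1]'(by simp; omega)) ⟨l.length, by omega⟩, fun f => ?_⟩
  rw [fullOp_eq_applyOp _ (by simp; omega), applyOp_eq _ _ n (by simp; omega),
    MultilinearMap.toLinearMap_apply]
  congr 1
  funext i
  rcases eq_or_ne i ⟨l.length, by omega⟩ with rfl | hi
  · simp
  · rw [Function.update_of_ne hi]
    have hi : i.1 ≠ l.length := fun e => hi (Fin.ext e)
    rcases lt_or_gt_of_ne hi with hi | hi
    · rw [List.getElem_append_left hi, List.getElem_append_left hi]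
    · rw [List.getElem_append_right hi.le, List.getElem_append_right hi.le]
      obtain ⟨k, hk⟩ : ∃ k, i.1 - l.length = k + 1 := ⟨i.1 - l.length - 1, by omega⟩
      simp [hk]

theorem lift_fullOp {A : Type w} [AddCommGroup A] [Module K A] [NAlgebra K A] (φ : X → A)
    (l : List (FreeNAlgebra K X)) :
    FreeNAlgebra.lift φ (fullOp (ops K (FreeNAlgebra K X)) l) =
      fullOp (ops K A) (l.map (FreeNAlgebra.lift φ)) := by
  match l with
  | [] => exact map_zero _
  | [a] => rfl
  | a :: b :: l =>
    rw [fullOp_eq_applyOp _ (by simp), fullOp_eq_applyOp _ (by simp),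
      applyOp_eq _ _ l.length (by simp), applyOp_eq _ _ l.length (by simp), FreeNAlgebra.lift_N]
    congr 1
    funext i
    exact (List.getElem_map _).symm

theorem ins_word (N : Words K X →ₗ[K] MonoidAlgebra K X) (hN : ∀ f, N (letter f) = f)
    (as : List X) (c : X) (cs : List X) :
    ins N (word K as) (word K (c :: cs)) =
      ∑ i ∈ Finset.range as.length,
          word K (as.take i) * (letter (N (word K (as.drop i ++ [c]))) * word K cs) -
        ∑ j ∈ Finset.range cs.length, word K as *
          (letter (N (word K (c :: cs.take (j + 1)))) * word K (cs.drop (j + 1))) := by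
  simpa [← letters_map_single, mul_assoc] using ins_letters N hN
    (as.map fun m => MonoidAlgebra.single m 1) (MonoidAlgebra.single c 1)
    (cs.map fun m => MonoidAlgebra.single m 1)

variable (K) in
/-- The arguments `d₁, …, d_p, x` of the monomial of the free `𝒩`-algebra that corresponds to the
tree `d₁ (⋯ (d_p x))`. -/
noncomputable def treeArgs : FreeMagma X → List (FreeNAlgebra K X)
  | .of x => [.of K x]
  | .mul c b => fullOp (ops K (FreeNAlgebra K X)) (treeArgs c) :: treeArgs b

variable (K) in
/-- The monomial of the free `𝒩`-algebra that corresponds to a tree. -/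
noncomputable def treeVal (b : FreeMagma X) : FreeNAlgebra K X :=
  fullOp (ops K (FreeNAlgebra K X)) (treeArgs K b)

theorem treeVal_rightComb (d : List (FreeMagma X)) (x : X) :
    treeVal K (rightComb d x) =
      fullOp (ops K (FreeNAlgebra K X)) (d.map (treeVal K) ++ [.of K x]) := by
  rw [treeVal]
  congr 1
  induction d with
  | nil => rfl
  | cons c d ih => rw [List.map_cons, List.cons_append, ← ih]; rfl

variable (K X) in
/-- The linear map from the space of trees to the free `𝒩`-algebra. -/
noncomputable def toFree : MonoidAlgebra K (FreeMagma X) →ₗ[K] FreeNAlgebra K X :=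
  extend (treeVal K)

theorem toFree_single (b : FreeMagma X) :
    toFree K X (MonoidAlgebra.single b 1) = treeVal K b := extend_single _ _

/-- The map to the free algebra on a tree with one argument replaced by a linear combination. -/
theorem toFree_act (l l' : List (FreeMagma X)) (f : MonoidAlgebra K (FreeMagma X)) (x : X) :
    toFree K X (act K (word K l * (letter f * word K l')) (MonoidAlgebra.single (.of x) 1)) =
      fullOp (ops K (FreeNAlgebra K X))
        (l.map (treeVal K) ++ toFree K X f :: (l'.map (treeVal K) ++ [.of K x])) := by
  obtain ⟨φ, hφ⟩ := exists_linear_fullOp (K := K) (l.map (treeVal K))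
    (l'.map (treeVal K) ++ [FreeNAlgebra.of K x]) (by simp)
  rw [hφ]
  induction f using single_induction with
  | zero => simp
  | add f g hf hg => simp only [map_add, add_mul, mul_add, LinearMap.add_apply, hf, hg]
  | smul r f hf => simp only [map_smul, smul_mul_assoc, mul_smul_comm, LinearMap.smul_apply, hf]
  | single b =>
    rw [← word_cons, ← word_append, act_word, toFree_single, toFree_single, ← hφ,
      treeVal_rightComb]
    simp

/-- The map to the free algebra respects the operations on trees: for a last argument
`d₁ (⋯ (d_p x))`, the insertion product expands to the right side of the relations, which hold in
the free algebra; induction on the last argument applies to the inner operations, since these have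
some `d_i` as their last argument. -/
theorem toFree_modelOp_concat (b : FreeMagma X) (a : List (FreeMagma X)) :
    toFree K X (modelOp K X (word K (a ++ [b]))) =
      fullOp (ops K (FreeNAlgebra K X)) ((a ++ [b]).map (treeVal K)) := by
  induction b using spine_induction generalizing a with
  | h d x ih =>
    rcases eq_or_ne a [] with rfl | ha
    · rw [List.nil_append, ← letter_single, modelOp_letter, toFree_single]
      rfl
    have ha' := word_mem_positive (K := K) ha
    rw [word_concat]
    cases d with
    | nil =>
      have e : rightComb [] x = FreeMagma.of x := rfl
      rw [e, modelOp_mul_leaf ha' x, act_word, toFree_single, treeVal_rightComb, List.map_append]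
      rfl
    | cons c cs =>
      have hc := word_mem_positive (K := K) (List.cons_ne_nil c cs)
      rw [← act_word (c :: cs) x, modelOp_mul_act ha' hc x, ins_word _ modelOp_letter, map_sub,
        map_sum, map_sum, LinearMap.sub_apply, LinearMap.sum_apply, LinearMap.sum_apply, map_sub,
        map_sum, map_sum, List.map_append, List.map_singleton, treeVal_rightComb, List.map_cons,
        List.cons_append, uniformRel_ops K _ _ _ _ (by simpa using ha), List.length_map,
        List.length_map]
      refine congrArg₂ _ (Finset.sum_congr rfl fun i _ => ?_) (Finset.sum_congr rfl fun j hj => ?_)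
      · rw [toFree_act, ih c (by simp)]
        simp [List.map_take, List.map_drop]
      · have hj := Finset.mem_range.1 hj
        have e : c :: cs.take (j + 1) = (c :: cs.take j) ++ [cs[j]] := by
          rw [List.cons_append, List.take_append_getElem]
        rw [toFree_act, e, ih _ (List.mem_cons_of_mem _ (List.getElem_mem _)), ← e]
        simp [List.map_take, List.map_drop]

theorem N_single (n : ℕ) (b : Fin (n + 2) → FreeMagma X) :
    NAlgebra.N (K := K) n (fun i => MonoidAlgebra.single (b i) (1 : K)) =
      modelOp K X (word K (List.ofFn b)) := by
  refine (multiOp_apply (modelOp K X) n _).trans ?_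
  have e : List.ofFn (fun i => MonoidAlgebra.single (b i) (1 : K)) =
      (List.ofFn b).map fun b => MonoidAlgebra.single b 1 := by rw [List.map_ofFn]; rfl
  rw [e, letters_map_single]

theorem toFree_N (n : ℕ) (v : Fin (n + 2) → MonoidAlgebra K (FreeMagma X)) :
    toFree K X (NAlgebra.N (K := K) n v) = NAlgebra.N (K := K) n fun i => toFree K X (v i) := by
  have h : (toFree K X).compMultilinearMap (NAlgebra.N (K := K) n) =
      (NAlgebra.N (K := K) n).compLinearMap fun _ => toFree K X := by
    refine Module.Basis.ext_multilinear (fun _ => MonoidAlgebra.basis (FreeMagma X) K) fun m => ?_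
    rw [LinearMap.compMultilinearMap_apply, MultilinearMap.compLinearMap_apply]
    simp only [MonoidAlgebra.basis_apply, toFree_single]
    rw [N_single, ← List.dropLast_append_getLast (l := List.ofFn m) (by simp),
      toFree_modelOp_concat, List.dropLast_append_getLast, fullOp_eq_applyOp _ (by simp),
      List.map_ofFn, applyOp_ofFn]
    rfl
  exact congrFun (congrArg DFunLike.coe h) v

variable (K X) in
/-- The morphism from the free `𝒩`-algebra to the space of trees. -/
noncomputable def ofFree : FreeNAlgebra K X →ₗ[K] MonoidAlgebra K (FreeMagma X) :=
  FreeNAlgebra.lift fun x => MonoidAlgebra.single (.of x) 1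

theorem ofFree_treeVal (b : FreeMagma X) :
    ofFree K X (treeVal K b) = MonoidAlgebra.single b 1 := by
  induction b using spine_induction with
  | h d x ih =>
    have e : (d.map (treeVal K) ++ [FreeNAlgebra.of K x]).map (ofFree K X) =
        (d ++ [FreeMagma.of x]).map fun b => MonoidAlgebra.single b (1 : K) := by
      rw [List.map_append, List.map_append, List.map_map]
      exact congrArg₂ _ (List.map_congr_left ih) rfl
    rw [treeVal_rightComb]
    refine (lift_fullOp _ _).trans ((congrArg _ e).trans ?_)
    rw [fullOp_ops_trees _ (by simp), letters_map_single]
    rcases eq_or_ne d [] with rfl | hd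
    · rw [List.nil_append, ← letter_single, modelOp_letter]; rfl
    · rw [modelOp_concat _ hd]; rfl

variable (K X) in
/-- The free `𝒩`-algebra is the space of planar binary trees. -/
noncomputable def freeEquiv : FreeNAlgebra K X ≃ₗ[K] MonoidAlgebra K (FreeMagma X) :=
  LinearEquiv.ofLinearMap (ofFree K X) (toFree K X)
    (extend_ext fun b => by
      rw [LinearMap.comp_apply, toFree_single, ofFree_treeVal]; rfl)
    (FreeNAlgebra.hom_ext
      (fun n v => by
        rw [LinearMap.comp_apply, ofFree, FreeNAlgebra.lift_N, toFree_N]; rfl)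
      (fun n v => rfl) fun x => by
        rw [LinearMap.comp_apply, ofFree, FreeNAlgebra.lift_of, toFree_single]; rfl)

end free

/-! ### Words of leaf labels -/

section words

variable {K : Type u} [Field K] {X : Type v}

/-- The word of leaf labels of a planar binary tree, read from left to right. -/
def treeWord : FreeMagma X → List X
  | .of x => [x]
  | .mul a b => treeWord a ++ treeWord b

theorem treeWord_mul (a b : FreeMagma X) : treeWord (a * b) = treeWord a ++ treeWord b := rfl

theorem treeWord_rightComb (d : List (FreeMagma X)) (x : X) :
    treeWord (rightComb d x) = (d.map treeWord).flatten ++ [x] := by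
  induction d with
  | nil => rfl
  | cons c d ih =>
    rw [List.map_cons, List.flatten_cons, List.append_assoc, ← ih]
    rfl

variable (K) in
/-- The span of the trees whose word of leaf labels is `w`. -/
noncomputable def treeSpan (w : List X) : Submodule K (MonoidAlgebra K (FreeMagma X)) :=
  Submodule.span K {f | ∃ b, treeWord b = w ∧ MonoidAlgebra.single b 1 = f}

theorem single_mem_treeSpan {b : FreeMagma X} {w : List X} (h : treeWord b = w) :
    MonoidAlgebra.single b 1 ∈ treeSpan K w := Submodule.subset_span ⟨b, h, rfl⟩

theorem mul_mem_treeSpan {f g : MonoidAlgebra K (FreeMagma X)} {w w' : List X}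
    (hf : f ∈ treeSpan K w) (hg : g ∈ treeSpan K w') : f * g ∈ treeSpan K (w ++ w') := by
  induction hf using Submodule.span_induction with
  | zero => simp
  | add f f' _ _ h h' => rw [add_mul]; exact add_mem h h'
  | smul r f _ h => rw [smul_mul_assoc]; exact Submodule.smul_mem _ _ h
  | mem f hf =>
    obtain ⟨b, rfl, rfl⟩ := hf
    induction hg using Submodule.span_induction with
    | zero => simp
    | add f f' _ _ h h' => rw [mul_add]; exact add_mem h h'
    | smul r f _ h => rw [mul_smul_comm]; exact Submodule.smul_mem _ _ h
    | mem g hg =>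
      obtain ⟨c, rfl, rfl⟩ := hg
      rw [MonoidAlgebra.single_mul_single, one_mul]
      exact single_mem_treeSpan rfl

/-- The operations on trees concatenate the words of leaf labels. -/
theorem opAux_mem_treeSpan (b : FreeMagma X) (a : List (FreeMagma X)) :
    (opAux K b).1 a ∈ treeSpan K ((a.map treeWord).flatten ++ treeWord b) ∧
      (opAux K b).2 a ∈ treeSpan K ((a.map treeWord).flatten ++ treeWord b) := by
  induction b generalizing a with
  | ih1 x => exact ⟨single_mem_treeSpan (treeWord_rightComb a x), Submodule.zero_mem _⟩
  | ih2 c b hc hb =>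
    rw [treeWord_mul]
    refine ⟨?_, ?_⟩
    · induction a with
      | nil =>
        refine Submodule.neg_mem _ ?_
        simpa using (hb [c]).2
      | cons e a ih =>
        change (opAux K c).1 (e :: a) * MonoidAlgebra.single b 1 +
          MonoidAlgebra.single e 1 * (opAux K (c * b)).1 a ∈ _
        refine add_mem ?_ ?_
        · rw [← List.append_assoc]
          exact mul_mem_treeSpan (hc _).1 (single_mem_treeSpan rfl)
        · rw [List.map_cons, List.flatten_cons, List.append_assoc]
          exact mul_mem_treeSpan (single_mem_treeSpan rfl) ih
    · change (opAux K c).1 a * MonoidAlgebra.single b 1 + (opAux K b).2 (a ++ [c]) ∈ _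
      refine add_mem ?_ ?_
      · rw [← List.append_assoc]
        exact mul_mem_treeSpan (hc _).1 (single_mem_treeSpan rfl)
      · simpa using (hb (a ++ [c])).2

theorem modelOp_word_mem_treeSpan {l : List (FreeMagma X)} (hl : l ≠ []) :
    modelOp K X (word K l) ∈ treeSpan K (l.map treeWord).flatten := by
  obtain ⟨a, b, rfl⟩ : ∃ a b, l = a ++ [b] := ⟨_, _, (List.dropLast_append_getLast hl).symm⟩
  rcases eq_or_ne a [] with rfl | ha
  · rw [List.nil_append, ← letter_single, modelOp_letter]
    exact single_mem_treeSpan (by simp)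
  · rw [modelOp_concat _ ha]
    simpa using (opAux_mem_treeSpan b a).1

theorem ofFree_eval_mem (t : PTree X) :
    ofFree K X (t.eval K (FreeNAlgebra.of K)) ∈ treeSpan K t.leaves := by
  rw [ofFree, FreeNAlgebra.lift_eval]
  induction t with
  | leaf x => exact single_mem_treeSpan rfl
  | node n f ih =>
    refine FreeNAlgebra.multilinear_mem (NAlgebra.N (K := K) n) _ _ ?_ _ ih
    intro b hb
    choose c hc e using hb
    obtain rfl : (fun i => MonoidAlgebra.single (c i) 1) = b := funext e
    rw [N_single]
    have h := modelOp_word_mem_treeSpan (K := K) (l := List.ofFn c) (by simp)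
    have e' : (List.ofFn c).map treeWord = List.ofFn fun i => (f i).leaves := by
      rw [List.map_ofFn]
      exact congrArg _ (funext hc)
    rwa [e'] at h

theorem fullOp_mem_wordSpan (l : List (FreeNAlgebra K X)) (ws : List (List X)) (hl : l ≠ [])
    (h : List.Forall₂ (fun a w => a ∈ FreeNAlgebra.wordSpan K {w}) l ws) :
    fullOp (ops K (FreeNAlgebra K X)) l ∈ FreeNAlgebra.wordSpan K {ws.flatten} := by
  match l, hl, ws, h with
  | [a], _, [w], h => simpa [fullOp] using h
  | a :: b :: l, _, ws, h =>
    obtain ⟨hlen, hget⟩ := List.forall₂_iff_get.1 h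
    rw [fullOp_eq_applyOp _ (by simp), applyOp_eq _ _ l.length (by simp)]
    have hw : ws.length = l.length + 2 := by simpa using hlen.symm
    refine FreeNAlgebra.N_mem_wordSpan _ (fun i => {ws[i.1]'(by omega)})
      (fun i => hget i.1 (by simp; omega) (by omega)) _ fun m hm => ?_
    refine congrArg List.flatten (List.ext_getElem (by simp [hw]) fun i h₁ h₂ => ?_)
    rw [List.getElem_ofFn]
    exact hm _

theorem treeVal_mem_wordSpan (b : FreeMagma X) :
    treeVal K b ∈ FreeNAlgebra.wordSpan K {treeWord b} := by
  induction b using spine_induction with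
  | h d x ih =>
    rw [treeVal_rightComb, treeWord_rightComb]
    have h := fullOp_mem_wordSpan (d.map (treeVal K) ++ [FreeNAlgebra.of K x])
      (d.map treeWord ++ [[x]]) (by simp) ?_
    · simpa using h
    · refine List.rel_append ?_ (.cons (Submodule.subset_span ⟨.leaf x, rfl, rfl⟩) .nil)
      rw [List.forall₂_map_left_iff, List.forall₂_map_right_iff, List.forall₂_same]
      exact ih

/-- The monomials attached to the trees with leaf word in `C` span the same space as all
monomials with leaf word in `C`. -/
theorem wordSpan_eq_span_treeVal (C : Set (List X)) :
    FreeNAlgebra.wordSpan K C = Submodule.span K (treeVal K '' {b | treeWord b ∈ C}) := by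
  refine le_antisymm (Submodule.span_le.2 ?_) (Submodule.span_le.2 ?_)
  · rintro _ ⟨t, ht, rfl⟩
    have h : toFree K X (ofFree K X (t.eval K (FreeNAlgebra.of K))) =
        t.eval K (FreeNAlgebra.of K) :=
      (freeEquiv K X).symm_apply_apply _
    rw [← h]
    have := Submodule.mem_map_of_mem (f := toFree K X) (ofFree_eval_mem (K := K) t)
    rw [treeSpan, Submodule.map_span] at this
    refine Submodule.span_mono ?_ this
    rintro _ ⟨_, ⟨b, hb, rfl⟩, rfl⟩
    exact ⟨b, by rwa [Set.mem_ofPred_eq, hb], (toFree_single b).symm⟩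
  · rintro _ ⟨b, hb, rfl⟩
    exact FreeNAlgebra.wordSpan_mono (Set.singleton_subset_iff.2 hb) (treeVal_mem_wordSpan b)

theorem linearIndependent_treeVal : LinearIndependent K (treeVal K : FreeMagma X → _) := by
  have h := ((MonoidAlgebra.basis (FreeMagma X) K).map (freeEquiv K X).symm).linearIndependent
  convert h using 1
  funext b
  exact (toFree_single b).symm

theorem rename_treeVal {Y : Type w} (g : X → Y) (b : FreeMagma X) :
    FreeNAlgebra.rename g (treeVal K b) = treeVal K (FreeMagma.map g b) := by
  induction b using spine_induction with
  | h d x ih =>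
    have e : FreeMagma.map g (rightComb d x) = rightComb (d.map (FreeMagma.map g)) (g x) := by
      clear ih
      induction d with
      | nil => rfl
      | cons c d ih =>
        change FreeMagma.map g (c * rightComb d x) = _
        rw [map_mul, ih]
        rfl
    rw [treeVal_rightComb, e, treeVal_rightComb]
    refine (lift_fullOp _ _).trans (congrArg _ ?_)
    rw [List.map_append, List.map_map, List.map_map]
    exact congrArg₂ _ (List.map_congr_left ih) rfl

theorem treeWord_map {Y : Type w} (g : X → Y) (b : FreeMagma X) :
    treeWord (FreeMagma.map g b) = (treeWord b).map g := by
  induction b with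
  | ih1 x => rfl
  | ih2 a b ha hb => rw [map_mul, treeWord_mul, treeWord_mul, ha, hb, List.map_append]

/-! ### Counting trees with a given leaf word -/

/-- The shape of a tree, forgetting the labels of the leaves. -/
def shape : FreeMagma X → BinaryTree Unit
  | .of _ => .nil
  | .mul a b => .node () (shape a) (shape b)

theorem length_treeWord (b : FreeMagma X) : (treeWord b).length = (shape b).numNodes + 1 := by
  induction b with
  | ih1 x => rfl
  | ih2 a b ha hb =>
    rw [treeWord_mul, List.length_append, ha, hb]
    change _ = (shape a).numNodes + (shape b).numNodes + 1 + 1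
    omega

theorem existsUnique_tree (t : BinaryTree Unit) (L : List X) (h : L.length = t.numNodes + 1) :
    ∃! b, shape b = t ∧ treeWord b = L := by
  induction t generalizing L with
  | nil =>
    obtain ⟨x, rfl⟩ := List.length_eq_one_iff.1 h
    refine ⟨.of x, ⟨rfl, rfl⟩, ?_⟩
    rintro (y | ⟨a, b⟩) ⟨h₁, h₂⟩
    · exact congrArg FreeMagma.of (List.singleton_injective h₂)
    · cases h₁
  | node u l r hl hr =>
    change L.length = l.numNodes + r.numNodes + 1 + 1 at h
    obtain ⟨a, ⟨ha, ha'⟩, hau⟩ := hl (L.take (l.numNodes + 1)) (by rw [List.length_take]; omega)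
    obtain ⟨b, ⟨hb, hb'⟩, hbu⟩ := hr (L.drop (l.numNodes + 1)) (by rw [List.length_drop]; omega)
    refine ⟨a * b, ⟨congrArg₂ (BinaryTree.node ()) ha hb, ?_⟩, ?_⟩
    · rw [treeWord_mul, ha', hb', List.take_append_drop]
    · rintro (y | ⟨a', b'⟩) ⟨h₁, h₂⟩
      · cases h₁
      · obtain ⟨-, h₃, h₄⟩ := BinaryTree.node.inj h₁
        have hlen : (treeWord a').length = l.numNodes + 1 := by rw [length_treeWord, h₃]
        have h₂ : treeWord a' ++ treeWord b' = L := h₂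
        rw [← h₂, ← hlen] at hau hbu
        rw [List.take_left] at hau
        rw [List.drop_left] at hbu
        rw [← hau a' ⟨h₃, rfl⟩, ← hbu b' ⟨h₄, rfl⟩]
        rfl

/-- Trees with a given nonempty leaf word correspond to their shapes. -/
noncomputable def treesWithWordEquiv (L : List X) (hL : L ≠ []) :
    {b : FreeMagma X // treeWord b = L} ≃ BinaryTree.treesOfNumNodesEq (L.length - 1) :=
  Equiv.ofBijective
    (fun b => ⟨shape b.1, by
      have := length_treeWord b.1
      rw [b.2] at this
      rw [BinaryTree.mem_treesOfNumNodesEq]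
      omega⟩) <| by
    refine ⟨?_, ?_⟩
    · rintro ⟨b, rfl⟩ ⟨c, hc⟩ h
      obtain ⟨a, -, ha⟩ := existsUnique_tree (shape b) (treeWord b) (length_treeWord b)
      exact Subtype.ext ((ha b ⟨rfl, rfl⟩).trans (ha c ⟨(congrArg Subtype.val h).symm, hc⟩).symm)
    · rintro ⟨t, ht⟩
      have hpos := List.length_pos_iff.2 hL
      rw [BinaryTree.mem_treesOfNumNodesEq] at ht
      obtain ⟨b, ⟨hb, hb'⟩, -⟩ := existsUnique_tree t L (by omega)
      exact ⟨⟨b, hb'⟩, Subtype.ext hb⟩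

end words

/-! ### The operad -/

section operad

open FreeNAlgebra

variable (K : Type u) [Field K]

/-- The basis of `𝒩(n)` given by the trees whose leaf word contains each variable exactly once. -/
noncomputable def multilinearBasis (n : ℕ) :
    Module.Basis {b : FreeMagma (Fin n) // treeWord b ∈ linearWords (Fin n)} K
      ((NOperad K).obj (Fin n)) :=
  (Module.Basis.span ((linearIndependent_treeVal (K := K)).comp
    (Subtype.val : {b : FreeMagma (Fin n) // treeWord b ∈ linearWords (Fin n)} → _)
    Subtype.val_injective)).map <| LinearEquiv.ofEq _ (multilinearPart K (Fin n)) <| by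
      rw [multilinearPart, wordSpan_eq_span_treeVal, Set.range_comp, Subtype.range_coe_subtype]

theorem coe_multilinearBasis (n : ℕ)
    (b : {b : FreeMagma (Fin n) // treeWord b ∈ linearWords (Fin n)}) :
    (show multilinearPart K (Fin n) from multilinearBasis K n b).1 = treeVal K b.1 :=
  congrArg Subtype.val (Module.Basis.span_apply ((linearIndependent_treeVal (K := K)).comp
    (Subtype.val : {b : FreeMagma (Fin n) // treeWord b ∈ linearWords (Fin n)} → _)
    Subtype.val_injective) b)

theorem finRange_mem_linearWords (n : ℕ) : List.finRange n ∈ linearWords (Fin n) :=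
  ⟨List.nodup_finRange n, List.mem_finRange⟩

/-- The basis of `𝒩ₙ` given by the trees whose leaf word is `0, 1, …, n - 1`. -/
noncomputable def planarBasis (n : ℕ) :
    Module.Basis {b : FreeMagma (Fin n) // treeWord b = List.finRange n} K
      ((NOperad.planar K).carrier n) :=
  (Module.Basis.span ((linearIndependent_treeVal (K := K)).comp
    (Subtype.val : {b : FreeMagma (Fin n) // treeWord b = List.finRange n} → _)
    Subtype.val_injective)).map <| (LinearEquiv.ofEq _ (wordSpan K {List.finRange n}) (by
      rw [wordSpan_eq_span_treeVal, Set.range_comp, Subtype.range_coe_subtype]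
      rfl)).trans (Submodule.comapSubtypeEquivOfLe
        (wordSpan_mono (Set.singleton_subset_iff.2 (finRange_mem_linearWords n)))).symm

theorem coe_planarBasis (n : ℕ) (b : {b : FreeMagma (Fin n) // treeWord b = List.finRange n}) :
    (show multilinearPart K (Fin n) from (planarBasis K n b).1).1 = treeVal K b.1 :=
  congrArg Subtype.val (Module.Basis.span_apply ((linearIndependent_treeVal (K := K)).comp
    (Subtype.val : {b : FreeMagma (Fin n) // treeWord b = List.finRange n} → _)
    Subtype.val_injective) b)

theorem map_map_tree {X : Type v} {Y : Type w} {Z : Type*} (g : Y → Z) (f : X → Y)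
    (b : FreeMagma X) : FreeMagma.map g (FreeMagma.map f b) = FreeMagma.map (g ∘ f) b := by
  induction b with
  | ih1 x => rfl
  | ih2 a b ha hb => rw [map_mul, map_mul, map_mul, ha, hb]

theorem map_id_tree {X : Type v} (b : FreeMagma X) : FreeMagma.map id b = b := by
  induction b with
  | ih1 x => rfl
  | ih2 a b ha hb => rw [map_mul, ha, hb]

/-- A tree with leaf word in `linearWords` is obtained, in a unique way, from a tree with leaf word
`0, 1, …, n - 1` by a permutation of the labels. -/
noncomputable def permuteLabels (n : ℕ) :
    {b : FreeMagma (Fin n) // treeWord b = List.finRange n} × Equiv.Perm (Fin n) ≃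
      {b : FreeMagma (Fin n) // treeWord b ∈ linearWords (Fin n)} :=
  Equiv.ofBijective
    (fun p => ⟨FreeMagma.map p.2 p.1.1, by
      rw [treeWord_map, p.1.2]
      exact ⟨(List.nodup_finRange n).map p.2.injective, fun x =>
        List.mem_map.2 ⟨p.2.symm x, List.mem_finRange _, p.2.apply_symm_apply x⟩⟩⟩) <| by
    refine ⟨?_, ?_⟩
    · rintro ⟨⟨b, hb⟩, σ⟩ ⟨⟨c, hc⟩, τ⟩ h
      have h : FreeMagma.map σ b = FreeMagma.map τ c := congrArg Subtype.val h
      have hw := congrArg treeWord h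
      rw [treeWord_map, treeWord_map, hb, hc] at hw
      obtain rfl : σ = τ := Equiv.ext fun i => List.map_inj_left.1 hw i (List.mem_finRange i)
      have h' := congrArg (FreeMagma.map σ.symm) h
      rw [map_map_tree, map_map_tree, Equiv.symm_comp_self, map_id_tree, map_id_tree] at h'
      subst h'
      rfl
    · rintro ⟨b, hb⟩
      have hlen : (treeWord b).length = n := by
        have := (Fintype.card_congr (hb.1.getEquivOfForallMemList _ hb.2))
        simpa using this
      obtain ⟨σ, hσ⟩ : ∃ σ : Equiv.Perm (Fin n), (List.finRange n).map σ = treeWord b := by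
        refine ⟨(finCongr hlen).symm.trans (hb.1.getEquivOfForallMemList _ hb.2), ?_⟩
        refine List.ext_getElem (by simp [hlen]) fun i h₁ h₂ => ?_
        simp [List.Nodup.getEquivOfForallMemList]
      refine ⟨(⟨FreeMagma.map σ.symm b, ?_⟩, σ), Subtype.ext ?_⟩
      · rw [treeWord_map, ← hσ, List.map_map, Equiv.symm_comp_self, List.map_id]
      · change FreeMagma.map σ (FreeMagma.map σ.symm b) = b
        rw [map_map_tree, Equiv.self_comp_symm, map_id_tree]

theorem symmetrization_tmul_single (Q : (NOperad K).NonSymmetricSuboperad) (n : ℕ)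
    (q : Q.carrier n) (σ : Equiv.Perm (Fin n)) :
    Q.symmetrization n (q ⊗ₜ MonoidAlgebra.single σ 1) = (NOperad K).map σ q.1 := by
  simp [SymmetricOperad.NonSymmetricSuboperad.symmetrization, SymmetricOperad.symmAction]

theorem planar_isNonSymmetricForm : (NOperad.planar K).IsNonSymmetricForm := by
  intro n
  let B := (planarBasis K n).tensorProduct (MonoidAlgebra.basis (Equiv.Perm (Fin n)) K)
  have h : (NOperad.planar K).symmetrization n =
      (B.equiv (multilinearBasis K n) (permuteLabels n)).toLinearMap := by
    refine B.ext fun p => ?_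
    rw [LinearEquiv.coe_coe, Module.Basis.equiv_apply, Module.Basis.tensorProduct_apply,
      MonoidAlgebra.basis_apply, symmetrization_tmul_single]
    refine Subtype.ext ?_
    refine Eq.trans ?_ (coe_multilinearBasis K n _).symm
    change rename p.2 (show multilinearPart K (Fin n) from (planarBasis K n p.1).1).1 = _
    rw [coe_planarBasis, rename_treeVal]
    rfl
  rw [h]
  exact LinearEquiv.bijective _

theorem rank_planar (n : ℕ) (hn : 1 ≤ n) :
    Module.rank K ((NOperad.planar K).carrier n) = (catalan (n - 1) : Cardinal.{u}) := by
  have hne : List.finRange n ≠ [] := by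
    rw [← List.length_pos_iff, List.length_finRange]; exact hn
  rw [rank_eq_card_basis ((planarBasis K n).reindex (treesWithWordEquiv _ hne)),
    Fintype.card_coe, BinaryTree.treesOfNumNodesEq_card_eq_catalan, List.length_finRange]

/-- All non-symmetric forms have the same dimensions, as `dim Qₙ` times `n!` is `dim 𝒩(n)`. -/
theorem rank_mul_of_isNonSymmetricForm {Q : (NOperad K).NonSymmetricSuboperad}
    (hQ : Q.IsNonSymmetricForm) (n : ℕ) :
    Module.rank K (Q.carrier n) * (n.factorial : Cardinal.{u}) =
      Module.rank K ((NOperad K).obj (Fin n)) := by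
  rw [← (LinearEquiv.ofBijective _ (hQ n)).rank_eq, rank_tensorProduct']
  rw [rank_eq_card_basis (MonoidAlgebra.basis (Equiv.Perm (Fin n)) K), Fintype.card_perm,
    Fintype.card_fin]

end operad
end NModel

theorem mainTheorem3 (K : Type u) [Field K] :
    (NOperad K).IsRegular ∧
      (NOperad.planar K).IsNonSymmetricForm ∧
      (∀ n : ℕ, 1 ≤ n →
        Module.rank K ((NOperad.planar K).carrier n) = (catalan (n - 1) : Cardinal.{u})) ∧
      ∀ Q : (NOperad K).NonSymmetricSuboperad, Q.IsNonSymmetricForm →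
        ∀ n : ℕ, 1 ≤ n → Module.rank K (Q.carrier n) = (catalan (n - 1) : Cardinal.{u}) := by
  have hP := NModel.planar_isNonSymmetricForm K
  refine ⟨⟨_, hP⟩, hP, NModel.rank_planar K, fun Q hQ n hn => ?_⟩
  have h := (NModel.rank_mul_of_isNonSymmetricForm K hQ n).trans
    (NModel.rank_mul_of_isNonSymmetricForm K hP n).symm
  rw [NModel.rank_planar K n hn] at h
  have hfin : Module.rank K (Q.carrier n) < Cardinal.aleph0 := by
    refine lt_of_le_of_lt (Cardinal.le_mul_right ?_) (h.trans_lt ?_)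
    · exact Nat.cast_ne_zero.2 n.factorial_ne_zero
    · rw [← Nat.cast_mul]
      exact Cardinal.natCast_lt_aleph0
  obtain ⟨k, hk⟩ := Cardinal.lt_aleph0.1 hfin
  rw [hk] at h ⊢
  norm_cast at h ⊢
  exact Nat.eq_of_mul_eq_mul_right n.factorial_pos h
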